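/- Let $\widehat{\mathcal A}$ be one of the spaces of sequences $\beta=(\beta_n)_{n\in\mathbb Z}$, $\ell^2_1\cap\ell^1$ or $\ell^1_s$ with $s\ge 1$, where $\beta\in\ell^p_s$ means $\sum_n|n|^s|\beta_n|^p<\infty$ and $\ell^1$ is the unweighted space. Let $\mathfrak A$ be the set of continuous functions $f:\partial\mathbb D\to\mathbb C$ whose Fourier coefficients lie in $\widehat{\mathcal A}$. For an open arc $I\subseteq\partial\mathbb D$ write $f\in\mathfrak A_{loc}(I)$ if for every $\theta_0\in I$ there is a smooth bump function $\chi$ on $\partial\mathbb D$, equal to $1$ near $\theta_0$, with $\chi f\in\mathfrak A$. Let $J$ be a Jacobi matrix with diagonal entries $b_n\in\mathbb R$ and off-diagonal entries $a_n>0$ $(n\ge1)$ such that $\sum_n b_n$ and $\sum_n(a_n^2-1)$ converge (possibly only conditionally), regarded as a bounded self-adjoint operator on $\ell^2(\mathbb N)$. Put $m(z)=\langle\delta_1,(J-z)^{-1}\delta_1\rangle$, where $\delta_1=(1,0,0,\dots)$, and $M(z)=-m(z+z^{-1})$ for $z\in\mathbb D$ (with $M(0)=0$). Write $M\in\mathcal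 M$ if the radial limit $M(\theta):=\lim_{r\uparrow1}M(re^{i\theta})$ exists and is finite at every $e^{i\theta}\ne\pm1$, and the boundary function $M(\theta)$ satisfies: 1. for every open arc $I\subseteq\partial\mathbb D$ avoiding $\pm1$, $M\in\mathfrak A_{loc}(I)$ and $\operatorname{Im}M\neq0$ on $I$; 2. for each $z_0\in\{-1,1\}$ there are an open arc $I\ni z_0$, a smooth bump function $\chi$ on $\partial\mathbb D$ supported in $I$ and equal to $1$ near $z_0$, and $G\in\mathfrak A$ with $\operatorname{Im}G\ne0$ on $I$, such that on $\partial\mathbb D\setminus\{\pm1\}$ either $$\chi(\theta)M(\theta)=\chi(\theta)\frac{G(\theta)}{\sin\theta},$$ or, for some $c\in\mathbb R$, $$\chi(\theta)M(\theta)=\chi(\theta)\bigl(c+\sin(\theta)\,G(\theta)\bigr).$$ Let $J^{(1)}$ be the Jacobi matrix obtained from $J$ by removing the first row and column, and let $M^{(1)}$ be its $M$-function. Then $M\in\mathcal M$ if and only if $M^{(1)}\in\mathcal M$. Consequently, if $J$ and $\widetilde J$ are two such Jacobi matrices with $J^{(1)}=\widetilde J^{(1)}$, and $M,\widetilde M$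 are their $M$-functions, then $M\in\mathcal M$ if and only if $\widetilde M\in\mathcal M$. -/

import Mathlib

open Filter Topology Set
open scoped ContDiff InnerProductSpace

noncomputable section

/-! ### Jacobi matrices -/

/-- A Jacobi matrix with conditionally summable parameters: off-diagonal entries `a n > 0`, diagonal
entries `b n`, such that the series `∑ b n` and `∑ (a n ^ 2 - 1)` converge (as limits of partial
sums). The indices start at `0`, so `a 0`, `b 0` are what is usually written `a₁`, `b₁`. -/
@[ext]
structure JacobiMatrix where
  a : ℕ → ℝ
  b : ℕ → ℝ
  a_pos : ∀ n, 0 < a n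
  summable_b : ∃ l : ℝ, Tendsto (fun N => ∑ k ∈ Finset.range N, b k) atTop (𝓝 l)
  summable_a : ∃ l : ℝ, Tendsto (fun N => ∑ k ∈ Finset.range N, (a k ^ 2 - 1)) atTop (𝓝 l)

theorem tendsto_zero_of_partialSums {f : ℕ → ℝ}
    (h : ∃ l : ℝ, Tendsto (fun N => ∑ k ∈ Finset.range N, f k) atTop (𝓝 l)) :
    Tendsto f atTop (𝓝 0) := by
  obtain ⟨l, hl⟩ := h
  have h1 := (hl.comp (tendsto_add_atTop_nat 1)).sub hl
  simpa [Function.comp_def, Finset.sum_range_succ] using h1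

theorem partialSums_shift {f : ℕ → ℝ}
    (h : ∃ l : ℝ, Tendsto (fun N => ∑ k ∈ Finset.range N, f k) atTop (𝓝 l)) :
    ∃ l : ℝ, Tendsto (fun N => ∑ k ∈ Finset.range N, f (k + 1)) atTop (𝓝 l) := by
  obtain ⟨l, hl⟩ := h
  refine ⟨l - f 0, ?_⟩
  have h1 := (hl.comp (tendsto_add_atTop_nat 1)).sub_const (f 0)
  simpa [Function.comp_def, Finset.sum_range_succ'] using h1

namespace JacobiMatrix

/-- The entries of the semi-infinite tridiagonal matrix `J`. -/
def entries (J : JacobiMatrix) : Matrix ℕ ℕ ℝ := fun i j =>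
  if i = j then J.b i else if j = i + 1 then J.a i else if i = j + 1 then J.a j else 0

/-- `J⁽¹⁾`: the Jacobi matrix obtained by removing the first row and the first column. -/
def removeFirst (J : JacobiMatrix) : JacobiMatrix where
  a n := J.a (n + 1)
  b n := J.b (n + 1)
  a_pos n := J.a_pos (n + 1)
  summable_b := partialSums_shift J.summable_b
  summable_a := partialSums_shift (f := fun k => J.a k ^ 2 - 1) J.summable_a

theorem removeFirst_entries (J : JacobiMatrix) :
    J.removeFirst.entries = J.entries.submatrix Nat.succ Nat.succ := by
  ext i j
  simp [entries, removeFirst]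

theorem bounded_b (J : JacobiMatrix) : ∃ C, ∀ n, |J.b n| ≤ C := by
  obtain ⟨C, hC⟩ := (tendsto_zero_of_partialSums J.summable_b).abs.bddAbove_range
  exact ⟨C, fun n => hC ⟨n, rfl⟩⟩

theorem bounded_a (J : JacobiMatrix) : ∃ C, ∀ n, |J.a n| ≤ C := by
  obtain ⟨C, hC⟩ := (tendsto_zero_of_partialSums J.summable_a).abs.bddAbove_range
  refine ⟨C + 2, fun n => ?_⟩
  have h : |J.a n ^ 2 - 1| ≤ C := hC ⟨n, rfl⟩
  have h2 := le_abs_self (J.a n ^ 2 - 1)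
  rw [abs_of_pos (J.a_pos n)]
  nlinarith [sq_nonneg (J.a n - 1), J.a_pos n]

/-- The Hilbert space `ℓ²(ℕ)`. -/
abbrev Hilb : Type := lp (fun _ : ℕ => ℂ) 2

/-- The action of `J` on sequences:
`(J u)ₙ = aₙ u_{n+1} + bₙ uₙ + a_{n-1} u_{n-1}`, without the last term for the first index. -/
def act (J : JacobiMatrix) (u : ℕ → ℂ) : ℕ → ℂ
  | 0 => J.a 0 * u 1 + J.b 0 * u 0
  | n + 1 => J.a (n + 1) * u (n + 2) + J.b (n + 1) * u (n + 1) + J.a n * u n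

theorem memlp_mul_bounded {c : ℕ → ℝ} (hc : ∃ C, ∀ n, |c n| ≤ C) {u : ℕ → ℂ}
    (hu : Memℓp u 2) : Memℓp (fun n => (c n : ℂ) * u n) 2 := by
  obtain ⟨C, hC⟩ := hc
  have hu' : Summable fun n => ‖u n‖ ^ (2 : ℝ) := by simpa using hu.summable (by norm_num)
  apply memℓp_gen
  have : Summable fun n => C ^ 2 * ‖u n‖ ^ (2 : ℝ) := hu'.mul_left _
  refine Summable.of_nonneg_of_le (fun n => by positivity) (fun n => ?_) this
  have h := hC n
  simp only [ENNReal.toReal_ofNat, norm_mul, Complex.norm_real, Real.norm_eq_abs,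
    Real.rpow_two, mul_pow]
  gcongr

theorem memlp_succ {u : ℕ → ℂ} (hu : Memℓp u 2) : Memℓp (fun n => u (n + 1)) 2 :=
  memℓp_gen ((summable_nat_add_iff 1).2 (hu.summable (by norm_num)))

theorem memlp_of_succ {u : ℕ → ℂ} (hu : Memℓp (fun n => u (n + 1)) 2) : Memℓp u 2 :=
  memℓp_gen ((summable_nat_add_iff (f := fun n => ‖u n‖ ^ (2 : ENNReal).toReal) 1).1
    (hu.summable (by norm_num)))

theorem memlp_act (J : JacobiMatrix) {u : ℕ → ℂ} (hu : Memℓp u 2) : Memℓp (J.act u) 2 := by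
  apply memlp_of_succ
  have h1 := memlp_succ (memlp_mul_bounded J.bounded_b hu)
  have h2 := memlp_mul_bounded J.bounded_a hu
  have h3 := memlp_succ (memlp_mul_bounded J.bounded_a (memlp_succ hu))
  exact (h3.add h1).add h2

/-- `J` as a linear operator on `ℓ²(ℕ)`. -/
def linOp (J : JacobiMatrix) : Hilb →ₗ[ℂ] Hilb where
  toFun u := ⟨J.act u, J.memlp_act u.2⟩
  map_add' u v := by
    ext n
    rcases n with _ | n <;> simp only [act, lp.coeFn_add, Pi.add_apply] <;> ring
  map_smul' c u := by
    ext n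
    rcases n with _ | n <;>
      simp only [act, lp.coeFn_smul, Pi.smul_apply, smul_eq_mul, RingHom.id_apply] <;> ring

theorem continuous_linOp (J : JacobiMatrix) : Continuous J.linOp := by
  have hcoord : ∀ n : ℕ, Continuous fun u : Hilb => u n := fun n =>
    ((continuous_apply n).comp (lp.uniformContinuous_coe (E := fun _ : ℕ => ℂ) (p := 2)).continuous)
  refine J.linOp.continuous_of_seq_closed_graph fun u x y hu hy => ?_
  ext n
  have h1 := ((hcoord n).tendsto y).comp hy
  have h2 : ∀ k, Tendsto (fun i => u i k) atTop (𝓝 (x k)) := fun k =>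
    ((hcoord k).tendsto x).comp hu
  refine tendsto_nhds_unique h1 ?_
  rcases n with _ | n
  · exact ((h2 1).const_mul _).add ((h2 0).const_mul _)
  · exact (((h2 (n + 2)).const_mul _).add ((h2 (n + 1)).const_mul _)).add ((h2 n).const_mul _)

/-- `J` as a bounded operator on `ℓ²(ℕ)`. -/
def op (J : JacobiMatrix) : Hilb →L[ℂ] Hilb := ⟨J.linOp, J.continuous_linOp⟩

/-- The operator has the entries of the matrix `J` in the standard basis. -/
theorem op_single (J : JacobiMatrix) (i j : ℕ) :
    (J.op (lp.single 2 j (1 : ℂ)) : ℕ → ℂ) i = (J.entries i j : ℂ) := by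
  change J.act (lp.single 2 j (1 : ℂ) : Hilb) i = _
  rcases i with _ | i <;> simp only [act, entries, lp.single_apply, Pi.single_apply] <;>
    split_ifs <;> first | omega | (exfalso; omega) | (subst_vars; simp)

/-- The first basis vector `δ₁ = (1, 0, 0, …)`. -/
def delta : Hilb := lp.single 2 0 1

/-- The `m`-function `m(z) = ⟨δ₁, (J - z)⁻¹ δ₁⟩` (meaningful for `z` outside the spectrum). -/
def mFun (J : JacobiMatrix) (z : ℂ) : ℂ :=
  inner ℂ delta (Ring.inverse (J.op - z • (1 : Hilb →L[ℂ] Hilb)) delta)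

/-- The `M`-function `M(z) = -m(z + z⁻¹)` on the unit disc; `z = 0` corresponds to the point at
infinity, where `m` vanishes. -/
def MFun (J : JacobiMatrix) (z : ℂ) : ℂ := if z = 0 then 0 else -J.mFun (z + z⁻¹)

end JacobiMatrix

/-! ### The function algebras -/

/-- The weighted space `ℓᵖ_s` of two-sided sequences: `∑ |n|^s |β n|^p < ∞`. Note that
`wlp 1 0` is the unweighted space `ℓ¹`. -/
def wlp (p s : ℝ) : Set (ℤ → ℂ) :=
  {β | Summable fun n : ℤ => |(n : ℝ)| ^ s * ‖β n‖ ^ p}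

/-- `A` is one of the sequence algebras `ℓ²₁ ∩ ℓ¹` or `ℓ¹_s` with `s ≥ 1`. -/
def IsSeqAlgebra (A : Set (ℤ → ℂ)) : Prop :=
  A = wlp 2 1 ∩ wlp 1 0 ∨ ∃ s : ℝ, 1 ≤ s ∧ A = wlp 1 s

/-- The circle `ℝ / 2πℤ` has positive length. -/
instance fact_two_pi_pos : Fact (0 < 2 * Real.pi) := ⟨Real.two_pi_pos⟩

/-- The continuous functions on the circle whose Fourier coefficients lie in `A`. -/
def InAlg (A : Set (ℤ → ℂ)) (f : Real.Angle → ℂ) : Prop :=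
  Continuous f ∧ (fun n : ℤ => fourierCoeff (T := 2 * Real.pi) f n) ∈ A

/-- A smooth cutoff function on the circle with values in `[0, 1]`. -/
def IsSmoothBump (χ : Real.Angle → ℝ) : Prop :=
  ContDiff ℝ ∞ (fun t : ℝ => χ (t : Real.Angle)) ∧ ∀ θ, χ θ ∈ Icc (0 : ℝ) 1

/-- `f` belongs locally to the algebra at the point `θ₀` of the circle. -/
def InAlgLocAt (A : Set (ℤ → ℂ)) (f : Real.Angle → ℂ) (θ₀ : Real.Angle) : Prop :=
  ∃ χ : Real.Angle → ℝ, IsSmoothBump χ ∧ (∀ᶠ θ in 𝓝 θ₀, χ θ = 1) ∧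
    InAlg A (fun θ => (χ θ : ℂ) * f θ)

/-- `f` belongs locally to the algebra on the set `I`. -/
def InAlgLoc (A : Set (ℤ → ℂ)) (f : Real.Angle → ℂ) (I : Set Real.Angle) : Prop :=
  ∀ θ₀ ∈ I, InAlgLocAt A f θ₀

/-- The open arc of the circle consisting of the angles in `(α, β)`. -/
def openArc (α β : ℝ) : Set Real.Angle := (fun t : ℝ => (t : Real.Angle)) '' Ioo α β

/-! ### The class `ℳ` -/

/-- `f` is the boundary function of `M` on the unit circle without `±1`: at each `e^{iθ} ≠ ±1` the
function `M` has the (finite) radial limit `f θ`. -/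
def IsBoundaryFunction (M : ℂ → ℂ) (f : Real.Angle → ℂ) : Prop :=
  ∀ θ : Real.Angle, θ.sin ≠ 0 →
    Tendsto (fun r : ℝ => M ((r : ℂ) * (θ.toCircle : ℂ))) (𝓝[<] 1) (𝓝 (f θ))

/-- The behaviour of the boundary function `f` required near a point `θ₀ ∈ {0, π}`, i.e. near
`z₀ = ±1`: up to a cutoff, `f` is `G / sin` or `c + sin · G` with `c` real, `G` in the algebra and
`Im G ≠ 0` near `θ₀`. The identities are between functions on the circle without `±1`. -/
def EndpointCondition (A : Set (ℤ → ℂ)) (f : Real.Angle → ℂ) (θ₀ : Real.Angle) : Prop :=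
  ∃ α β : ℝ, θ₀ ∈ openArc α β ∧
    ∃ χ : Real.Angle → ℝ, IsSmoothBump χ ∧ tsupport χ ⊆ openArc α β ∧ (∀ᶠ θ in 𝓝 θ₀, χ θ = 1) ∧
      ∃ G : Real.Angle → ℂ, InAlg A G ∧ (∀ θ ∈ openArc α β, (G θ).im ≠ 0) ∧
        ((∀ θ : Real.Angle, θ.sin ≠ 0 →
            (χ θ : ℂ) * f θ = (χ θ : ℂ) * (G θ / (θ.sin : ℂ))) ∨
          ∃ c : ℝ, ∀ θ : Real.Angle, θ.sin ≠ 0 →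
            (χ θ : ℂ) * f θ = (χ θ : ℂ) * ((c : ℂ) + (θ.sin : ℂ) * G θ))

/-- The class `ℳ` attached to the sequence algebra `A`: the functions `M` on the disc whose boundary
values `f` are locally in the algebra with `Im f ≠ 0` on each open arc avoiding `±1`, and satisfy the
endpoint condition at `±1`. -/
def InClassM (A : Set (ℤ → ℂ)) (M : ℂ → ℂ) : Prop :=
  ∃ f : Real.Angle → ℂ, IsBoundaryFunction M f ∧
    (∀ α β : ℝ, (∀ θ ∈ openArc α β, θ.sin ≠ 0) →
      InAlgLoc A f (openArc α β) ∧ ∀ θ ∈ openArc α β, (f θ).im ≠ 0) ∧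
    EndpointCondition A f 0 ∧ EndpointCondition A f (Real.pi : Real.Angle)

end

/-! Coefficient stripping gives `M (z + z⁻¹ - b₁ - a₁² M⁽¹⁾) = 1` on the disc wherever `z + z⁻¹` is
not real, hence `1 / M = 2 cos θ - b₁ - a₁² M⁽¹⁾` in the radial limit. Passing between `M` and
`M⁽¹⁾` therefore uses only inversion and the real affine map `f ↦ x f + y cos θ + b` with `x ≠ 0`.
It suffices that the conditions on the boundary function survive both operations
(`BoundaryClass.inv`, `BoundaryClass.affine`).

Away from `±1`, `Im f ≠ 0` forces `f ≠ 0`, and a local Wiener lemma (`InAlg.exists_local_inverse`)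
keeps `1 / f` in the algebra. At `±1`, inversion exchanges `G / sin` and `sin · G`, and preserves
the form `c + sin · G` when `c ≠ 0`. The affine map preserves both forms because `cos θ ∓ 1` is
`sin² θ` times a smooth function there.

The Wiener lemma rests on two facts: the norm `‖β‖₁ + ‖|n|^t β‖_p` is submultiplicative up to a
constant (Young's inequality), and the spectral radius in the algebra is at most the sup norm. The
second holds because trigonometric polynomials are dense and their algebra norm exceeds the sup norm
by at most a polynomial factor in the degree. -/

namespace JacobiMatrix

/-! ### Self-adjointness and coefficient stripping. -/

theorem entries_symm (J : JacobiMatrix) (i j : ℕ) : J.entries i j = J.entries j i := by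
  simp only [entries]
  split_ifs <;> first | omega | (subst_vars; rfl)

/-- The matrix is real and symmetric, so `J` and its adjoint agree on basis vectors, and by
continuity on their convergent expansions. This places the spectrum on the real line. -/
theorem isSelfAdjoint_op (J : JacobiMatrix) : IsSelfAdjoint J.op := by
  rw [ContinuousLinearMap.isSelfAdjoint_iff']
  have hcoord : ∀ (T : Hilb →L[ℂ] Hilb) (u : Hilb),
      HasSum (fun n => T (lp.single 2 n (u n))) (T u) := fun T u =>
    (lp.hasSum_single (by norm_num) u).mapL T
  ext1 u
  refine (hcoord _ u).unique ?_
  convert hcoord J.op u using 2 with n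
  have h1 : (lp.single 2 n (u n) : Hilb) = u n • lp.single 2 n (1 : ℂ) := by
    rw [← lp.single_smul, smul_eq_mul, mul_one]
  rw [h1, map_smul, map_smul]
  congr 1
  apply lp.ext
  funext i
  have h2 : ∀ x : Hilb, x i = inner ℂ (lp.single 2 i (1 : ℂ)) x := fun x => by
    rw [lp.inner_single_left]; simp
  rw [h2, ContinuousLinearMap.adjoint_inner_right, lp.inner_single_right, J.op_single, J.op_single,
    entries_symm]
  simp

theorem isUnit_op_sub (J : JacobiMatrix) {z : ℂ} (hz : z.im ≠ 0) :
    IsUnit (J.op - z • (1 : Hilb →L[ℂ] Hilb)) := by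
  have h : z ∉ spectrum ℂ J.op := fun h => hz (J.isSelfAdjoint_op.im_eq_zero_of_mem_spectrum h)
  rw [spectrum.notMem_iff, Algebra.algebraMap_eq_smul_one] at h
  rw [← neg_sub]
  exact h.neg

theorem mFun_eq (J : JacobiMatrix) {z : ℂ} {u : Hilb} (hz : z.im ≠ 0)
    (hu : J.op u - z • u = delta) : J.mFun z = u 0 := by
  have h : Ring.inverse (J.op - z • (1 : Hilb →L[ℂ] Hilb)) delta = u := by
    have : delta = (J.op - z • (1 : Hilb →L[ℂ] Hilb)) u := by simp [hu]
    rw [this, ← mul_apply_eq_comp, Ring.inverse_mul_cancel _ (J.isUnit_op_sub hz)]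
    rfl
  rw [mFun, h, delta, lp.inner_single_left]
  simp

theorem exists_resolvent (J : JacobiMatrix) {z : ℂ} (hz : z.im ≠ 0) (v : Hilb) :
    ∃ u : Hilb, J.op u - z • u = v := by
  refine ⟨Ring.inverse (J.op - z • (1 : Hilb →L[ℂ] Hilb)) v, ?_⟩
  have := congrArg (fun T : Hilb →L[ℂ] Hilb => T v)
    (Ring.mul_inverse_cancel _ (J.isUnit_op_sub hz))
  simpa using this

theorem resolvent_injective (J : JacobiMatrix) {z : ℂ} (hz : z.im ≠ 0) {u v : Hilb}
    (h : J.op u - z • u = J.op v - z • v) : u = v := by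
  have h1 : (J.op - z • (1 : Hilb →L[ℂ] Hilb)) u = (J.op - z • (1 : Hilb →L[ℂ] Hilb)) v := by
    simpa using h
  have h2 := congrArg (⇑(Ring.inverse (J.op - z • (1 : Hilb →L[ℂ] Hilb)))) h1
  simpa only [← mul_apply_eq_comp, Ring.inverse_mul_cancel _ (J.isUnit_op_sub hz), one_apply_eq_self]
    using h2

/-- The coefficient stripping relation for the `m`-function. -/
theorem mFun_mul_removeFirst (J : JacobiMatrix) {z : ℂ} (hz : z.im ≠ 0) :
    J.mFun z * (J.b 0 - z - J.a 0 ^ 2 * J.removeFirst.mFun z) = 1 := by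
  obtain ⟨u, hu⟩ := J.exists_resolvent hz delta
  obtain ⟨w, hw⟩ := J.removeFirst.exists_resolvent hz delta
  rw [J.mFun_eq hz hu, J.removeFirst.mFun_eq hz hw]
  have hu' : ∀ n, J.act u n - z * u n = (delta : Hilb) n := fun n => by
    rw [← hu]; rfl
  -- Rows below the top one of `(J - z) u = δ₁` say that the shifted tail `v` solves the stripped
  -- equation with right side `-a₁ u₀ δ₁`. Uniqueness makes `v` a multiple of `w`, and the top row
  -- then yields the relation.
  let v : Hilb := ⟨fun n => u (n + 1), memlp_succ u.2⟩
  have hv : v = (-(J.a 0 : ℂ) * u 0) • w := by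
    apply J.removeFirst.resolvent_injective hz
    rw [map_smul, smul_comm z, ← smul_sub, hw]
    apply lp.ext
    funext n
    have h := hu' (n + 1)
    have e : (J.removeFirst.op v - z • v : Hilb) n
        = J.removeFirst.act (fun n => u (n + 1)) n - z * u (n + 1) := rfl
    rw [e, lp.coeFn_smul, Pi.smul_apply, smul_eq_mul]
    rcases n with _ | n
    · simp only [act, removeFirst, delta, lp.single_apply] at h ⊢
      simp at h ⊢
      linear_combination h
    · simp only [act, removeFirst, delta, lp.single_apply] at h ⊢
      simp at h ⊢
      linear_combination h
  have h1 : u 1 = -(J.a 0 : ℂ) * u 0 * w 0 := by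
    calc u 1 = v 0 := rfl
      _ = _ := by rw [hv, lp.coeFn_smul, Pi.smul_apply, smul_eq_mul]
  have h0 := hu' 0
  simp only [act, delta, lp.single_apply] at h0
  simp at h0
  rw [h1] at h0
  linear_combination h0

/-- The coefficient stripping relation for the `M`-function. -/
theorem MFun_mul_removeFirst (J : JacobiMatrix) {z : ℂ} (hz : (z + z⁻¹).im ≠ 0) :
    J.MFun z * (z + z⁻¹ - J.b 0 - J.a 0 ^ 2 * J.removeFirst.MFun z) = 1 := by
  -- Since `0⁻¹ = 0`, the hypothesis on the imaginary part already excludes the special value at the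
  -- origin.
  have h0 : z ≠ 0 := by rintro rfl; simp at hz
  simp only [MFun, if_neg h0]
  linear_combination J.mFun_mul_removeFirst hz

end JacobiMatrix

/-! ### Weighted sequence norms and convolution. -/

open scoped ENNReal

/-- The `ℓᵖ` norm of a sequence of extended nonnegative numbers. -/
noncomputable def ellNorm {ι : Type*} (p : ℝ) (F : ι → ℝ≥0∞) : ℝ≥0∞ := (∑' n, F n ^ p) ^ (1 / p)

section ellNorm
variable {ι κ : Type*} {p : ℝ}

theorem ellNorm_mono (hp : 1 ≤ p) {F G : ι → ℝ≥0∞} (h : ∀ n, F n ≤ G n) :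
    ellNorm p F ≤ ellNorm p G := by
  unfold ellNorm
  gcongr
  exact h _

theorem ellNorm_const_mul (hp : 1 ≤ p) (c : ℝ≥0∞) (F : ι → ℝ≥0∞) :
    ellNorm p (fun n => c * F n) = c * ellNorm p F := by
  have hp0 : p ≠ 0 := by linarith
  unfold ellNorm
  simp_rw [ENNReal.mul_rpow_of_nonneg _ _ (zero_le_one.trans hp), ENNReal.tsum_mul_left]
  rw [ENNReal.mul_rpow_of_nonneg _ _ (by positivity), ← ENNReal.rpow_mul, mul_one_div_cancel hp0,
    ENNReal.rpow_one]

theorem ellNorm_comp_equiv (e : κ ≃ ι) (F : ι → ℝ≥0∞) :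
    ellNorm p (fun k => F (e k)) = ellNorm p F := by
  unfold ellNorm
  rw [e.tsum_eq (fun n => F n ^ p)]

/-- **Minkowski inequality** for infinite sums. -/
theorem ellNorm_tsum_le (hp : 1 ≤ p) (F : κ → ι → ℝ≥0∞) :
    ellNorm p (fun n => ∑' k, F k n) ≤ ∑' k, ellNorm p (F k) := by
  have hp0 : 0 < p := by linarith
  -- The finite case follows by induction from the two-term inequality; the limit is then taken over
  -- `T`, afterwards over `S`.
  have hfin : ∀ (S : Finset ι) (T : Finset κ),
      (∑ n ∈ S, (∑ k ∈ T, F k n) ^ p) ^ (1 / p) ≤ ∑ k ∈ T, (∑ n ∈ S, F k n ^ p) ^ (1 / p) := by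
    classical
    intro S T
    induction T using Finset.induction_on with
    | empty => simp [hp0]
    | insert a T ha ih =>
      simp only [Finset.sum_insert ha]
      exact (ENNReal.Lp_add_le S _ _ hp).trans (by gcongr)
  have h1 : ∀ S : Finset ι,
      (∑ n ∈ S, (∑' k, F k n) ^ p) ^ (1 / p) ≤ ∑' k, ellNorm p (F k) := by
    intro S
    have ht : Tendsto (fun T : Finset κ => (∑ n ∈ S, (∑ k ∈ T, F k n) ^ p) ^ (1 / p)) atTop
        (𝓝 ((∑ n ∈ S, (∑' k, F k n) ^ p) ^ (1 / p))) := by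
      refine (ENNReal.continuous_rpow_const.tendsto _).comp (tendsto_finsetSum _ fun n _ => ?_)
      exact (ENNReal.continuous_rpow_const.tendsto _).comp ENNReal.summable.hasSum
    refine le_of_tendsto' ht fun T => (hfin S T).trans ?_
    refine le_trans (Finset.sum_le_sum fun k _ => ?_) (ENNReal.sum_le_tsum T)
    unfold ellNorm
    gcongr
    exact ENNReal.sum_le_tsum S
  have h2 : Tendsto (fun S : Finset ι => (∑ n ∈ S, (∑' k, F k n) ^ p) ^ (1 / p)) atTop
      (𝓝 (ellNorm p (fun n => ∑' k, F k n))) :=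
    (ENNReal.continuous_rpow_const.tendsto _).comp ENNReal.summable.hasSum
  exact le_of_tendsto' h2 h1

theorem ellNorm_add_le (hp : 1 ≤ p) (F G : ι → ℝ≥0∞) :
    ellNorm p (fun n => F n + G n) ≤ ellNorm p F + ellNorm p G := by
  have := ellNorm_tsum_le hp (fun b : Bool => if b then F else G)
  simpa [tsum_bool, add_comm] using this

/-- `F` is the sum of its point masses, each of norm `F k`, so Minkowski applies. -/
theorem ellNorm_le_tsum (hp : 1 ≤ p) (F : ι → ℝ≥0∞) : ellNorm p F ≤ ∑' n, F n := by
  classical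
  have hp0 : 0 < p := by linarith
  have h := ellNorm_tsum_le hp (fun k : ι => Pi.single (M := fun _ => ℝ≥0∞) k (F k))
  have e1 : (fun n => ∑' k, Pi.single (M := fun _ => ℝ≥0∞) k (F k) n) = F := by
    funext n
    rw [tsum_eq_single n]
    · simp
    · intro k hk
      simp [hk.symm]
  have e2 : ∀ k, ellNorm p (Pi.single (M := fun _ => ℝ≥0∞) k (F k)) = F k := by
    intro k
    unfold ellNorm
    rw [tsum_eq_single k]
    · rw [Pi.single_eq_same, ← ENNReal.rpow_mul, mul_one_div_cancel hp0.ne', ENNReal.rpow_one]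
    · intro n hn
      simp [hn, hp0]
  rwa [e1, tsum_congr e2] at h

end ellNorm

/-- **Young's inequality** for the convolution of an `ℓ¹` and an `ℓᵖ` sequence. -/
theorem ellNorm_conv_le {p : ℝ} (hp : 1 ≤ p) (F G : ℤ → ℝ≥0∞) :
    ellNorm p (fun n => ∑' k, F k * G (n - k)) ≤ (∑' k, F k) * ellNorm p G := by
  refine (ellNorm_tsum_le hp _).trans_eq ?_
  rw [← ENNReal.tsum_mul_right]
  refine tsum_congr fun k => ?_
  rw [ellNorm_const_mul hp]
  congr 1
  exact ellNorm_comp_equiv (Equiv.subRight k) G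

/-- The weight `|n|^t`. -/
noncomputable def wt (t : ℝ) (n : ℤ) : ℝ≥0∞ := ENNReal.ofReal (|(n : ℝ)| ^ t)

/-- The larger of `|k|` and `|n - k|` is at least `|n| / 2`. This lets the weight of a convolution
be moved onto one factor at a time. -/
theorem wt_le {t : ℝ} (ht : 0 ≤ t) (n k : ℤ) :
    wt t n ≤ ENNReal.ofReal (2 ^ t) * (wt t k + wt t (n - k)) := by
  unfold wt
  rw [← ENNReal.ofReal_add (by positivity) (by positivity), ← ENNReal.ofReal_mul (by positivity)]
  apply ENNReal.ofReal_le_ofReal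
  have h1 : |(n : ℝ)| ≤ 2 * max |(k : ℝ)| |((n - k : ℤ) : ℝ)| := by
    have : (n : ℝ) = k + ((n - k : ℤ) : ℝ) := by push_cast; ring
    rw [two_mul]
    nth_rewrite 1 [this]
    exact (abs_add_le _ _).trans (add_le_add (le_max_left _ _) (le_max_right _ _))
  refine (Real.rpow_le_rpow (abs_nonneg _) h1 ht).trans ?_
  rw [Real.mul_rpow (by norm_num) (by positivity)]
  gcongr
  rcases max_choice |(k : ℝ)| |((n - k : ℤ) : ℝ)| with h | h <;> rw [h]
  · exact le_add_of_nonneg_right (by positivity)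
  · exact le_add_of_nonneg_left (by positivity)

/-- The constant which makes `algNorm` submultiplicative. -/
noncomputable def algConst (t : ℝ) : ℝ≥0∞ := 1 + ENNReal.ofReal (2 ^ t)

/-- The norm `‖β‖_{ℓ¹} + ‖|n|^t β‖_{ℓᵖ}`, up to a constant factor, of a sequence `β` of
extended nonnegative numbers. -/
noncomputable def seqNorm (p t : ℝ) (F : ℤ → ℝ≥0∞) : ℝ≥0∞ :=
  algConst t * (∑' n, F n + ellNorm p (fun n => wt t n * F n))

section seqNorm
variable {p t : ℝ}

theorem algConst_ne_top : algConst t ≠ ⊤ := by simp [algConst]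

theorem one_le_algConst : 1 ≤ algConst t := by simp [algConst]

theorem tsum_le_seqNorm (F : ℤ → ℝ≥0∞) : ∑' n, F n ≤ seqNorm p t F := by
  unfold seqNorm
  calc _ ≤ ∑' n, F n + ellNorm p (fun n => wt t n * F n) := le_self_add
    _ ≤ _ := le_mul_of_one_le_left zero_le one_le_algConst

theorem seqNorm_mono (hp : 1 ≤ p) {F G : ℤ → ℝ≥0∞} (h : ∀ n, F n ≤ G n) :
    seqNorm p t F ≤ seqNorm p t G := by
  unfold seqNorm
  gcongr with n
  · exact h n
  · exact ellNorm_mono hp fun n => by gcongr; exact h n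

theorem seqNorm_tsum_le {κ : Type*} (hp : 1 ≤ p) (F : κ → ℤ → ℝ≥0∞) :
    seqNorm p t (fun n => ∑' k, F k n) ≤ ∑' k, seqNorm p t (F k) := by
  unfold seqNorm
  rw [ENNReal.tsum_mul_left, ENNReal.tsum_add, ENNReal.tsum_comm]
  gcongr
  simp_rw [← ENNReal.tsum_mul_left]
  exact ellNorm_tsum_le hp _

theorem seqNorm_add_le (hp : 1 ≤ p) (F G : ℤ → ℝ≥0∞) :
    seqNorm p t (fun n => F n + G n) ≤ seqNorm p t F + seqNorm p t G := by
  have := seqNorm_tsum_le (t := t) hp (fun b : Bool => if b then F else G)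
  simpa [tsum_bool, add_comm] using this

theorem seqNorm_const_mul (hp : 1 ≤ p) (c : ℝ≥0∞) (F : ℤ → ℝ≥0∞) :
    seqNorm p t (fun n => c * F n) = c * seqNorm p t F := by
  unfold seqNorm
  simp_rw [mul_left_comm _ c]
  rw [ENNReal.tsum_mul_left, ellNorm_const_mul hp]
  ring

theorem seqNorm_le_tsum (hp : 1 ≤ p) (F : ℤ → ℝ≥0∞) :
    seqNorm p t F ≤ algConst t * ∑' n, (1 + wt t n) * F n := by
  unfold seqNorm
  gcongr
  simp_rw [add_mul, one_mul]
  rw [ENNReal.tsum_add]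
  gcongr
  exact ellNorm_le_tsum hp _

/-- After `wt_le`, each weighted convolution has one unweighted `ℓ¹` factor and one weighted `ℓᵖ`
factor, as Young's inequality requires. -/
theorem seqNorm_conv_le (hp : 1 ≤ p) (ht : 0 ≤ t) (F G : ℤ → ℝ≥0∞) :
    seqNorm p t (fun n => ∑' k, F k * G (n - k)) ≤ seqNorm p t F * seqNorm p t G := by
  set c := ENNReal.ofReal (2 ^ t) with hc
  have h1 : ∑' n, ∑' k, F k * G (n - k) = (∑' n, F n) * ∑' n, G n := by
    rw [ENNReal.tsum_comm, ← ENNReal.tsum_mul_right]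
    refine tsum_congr fun k => ?_
    rw [ENNReal.tsum_mul_left, ← (Equiv.subRight k).tsum_eq G]
    rfl
  -- Reversing the convolution puts the unweighted factor in the `ℓ¹` slot of `ellNorm_conv_le`.
  have h3 : ∀ n, ∑' k, (wt t k * F k) * G (n - k) = ∑' k, G k * (wt t (n - k) * F (n - k)) := by
    intro n
    rw [← (Equiv.subLeft n).tsum_eq]
    refine tsum_congr fun k => ?_
    simp [mul_comm]
  have h2 : ellNorm p (fun n => wt t n * ∑' k, F k * G (n - k)) ≤
      c * ((∑' n, G n) * ellNorm p (fun n => wt t n * F n) +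
        (∑' n, F n) * ellNorm p (fun n => wt t n * G n)) := by
    calc _ ≤ ellNorm p (fun n => c * (∑' k, G k * (wt t (n - k) * F (n - k)) +
          ∑' k, F k * (wt t (n - k) * G (n - k)))) := by
          refine ellNorm_mono hp fun n => ?_
          rw [← h3, ← ENNReal.tsum_add, ← ENNReal.tsum_mul_left, ← ENNReal.tsum_mul_left]
          refine ENNReal.tsum_le_tsum fun k => ?_
          calc _ ≤ c * (wt t k + wt t (n - k)) * (F k * G (n - k)) := by gcongr; exact wt_le ht n k
            _ = _ := by ring
      _ ≤ _ := by
          rw [ellNorm_const_mul hp]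
          gcongr
          refine (ellNorm_add_le hp _ _).trans ?_
          gcongr
          · exact ellNorm_conv_le hp G _
          · exact ellNorm_conv_le hp F _
  unfold seqNorm
  rw [h1]
  set x := ∑' n, F n
  set y := ∑' n, G n
  set X := ellNorm p (fun n => wt t n * F n)
  set Y := ellNorm p (fun n => wt t n * G n)
  have hK : c ≤ algConst t := le_add_self
  have hK1 : 1 ≤ algConst t := one_le_algConst
  -- The missing term `X * Y` is added to complete the product `(x + X) * (y + Y)`.
  calc algConst t * (x * y + ellNorm p (fun n => wt t n * ∑' k, F k * G (n - k)))
      ≤ algConst t * (algConst t * (x * y) + algConst t * (y * X + x * Y)) := by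
        refine mul_le_mul_right (add_le_add (le_mul_of_one_le_left zero_le hK1) (h2.trans ?_)) _
        gcongr
    _ ≤ algConst t * (algConst t * (x * y) + algConst t * (y * X + x * Y)) +
        algConst t * algConst t * (X * Y) := le_self_add
    _ = _ := by ring

end seqNorm

/-! ### The algebra of functions with weighted summable Fourier coefficients. -/

section FourierAlgebra
variable {T : ℝ} [hT : Fact (0 < T)]

theorem integrable_haarAddCircle (f : C(AddCircle T, ℂ)) :
    MeasureTheory.Integrable f AddCircle.haarAddCircle :=
  f.continuous.integrable_of_hasCompactSupport (HasCompactSupport.of_compactSpace f)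

theorem norm_fourierCoeff_le (f : C(AddCircle T, ℂ)) (n : ℤ) : ‖fourierCoeff f n‖ ≤ ‖f‖ := by
  unfold fourierCoeff
  refine (MeasureTheory.norm_integral_le_of_norm_le_const (C := ‖f‖)
    (MeasureTheory.ae_of_all _ fun x => ?_)).trans (by simp)
  rw [norm_smul, fourier_apply, Circle.norm_coe, one_mul]
  exact f.norm_coe_le_norm x

/-- The `n`-th Fourier coefficient as a continuous linear functional. -/
noncomputable def fourierCoeffCLM (n : ℤ) : C(AddCircle T, ℂ) →L[ℂ] ℂ :=
  LinearMap.mkContinuous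
    { toFun := fun f => fourierCoeff f n
      map_add' := fun f g => congrFun
        (fourierCoeff.add (integrable_haarAddCircle f) (integrable_haarAddCircle g)) n
      map_smul' := fun c f => fourierCoeff.const_smul f c n } 1
    fun f => by simpa using norm_fourierCoeff_le f n

theorem fourierCoeffCLM_apply (n : ℤ) (f : C(AddCircle T, ℂ)) :
    fourierCoeffCLM n f = fourierCoeff f n := rfl

theorem fourierCoeff_fourier_mul (k n : ℤ) (f : C(AddCircle T, ℂ)) :
    fourierCoeff (fourier k * f : C(AddCircle T, ℂ)) n = fourierCoeff f (n - k) := by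
  unfold fourierCoeff
  congr 1
  funext x
  rw [ContinuousMap.mul_apply, smul_eq_mul, smul_eq_mul, ← mul_assoc, ← fourier_add]
  congr 3
  ring

theorem enorm_fourierCoeff_le_tsum {κ : Type*} {F : κ → C(AddCircle T, ℂ)}
    {f : C(AddCircle T, ℂ)} (h : HasSum F f) (n : ℤ) :
    ‖fourierCoeff f n‖ₑ ≤ ∑' k, ‖fourierCoeff (F k) n‖ₑ := by
  have h1 := h.mapL (fourierCoeffCLM n)
  simp only [fourierCoeffCLM_apply] at h1
  rw [← h1.tsum_eq]
  exact enorm_tsum_le_tsum_enorm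

/-- The norm of the Fourier coefficients of a continuous function. -/
noncomputable def algNorm (p t : ℝ) (f : C(AddCircle T, ℂ)) : ℝ≥0∞ :=
  seqNorm p t fun n => ‖fourierCoeff f n‖ₑ

variable {p t : ℝ}

theorem algNorm_le_tsum (hp : 1 ≤ p) {κ : Type*} {F : κ → C(AddCircle T, ℂ)}
    {f : C(AddCircle T, ℂ)} (h : HasSum F f) : algNorm p t f ≤ ∑' k, algNorm p t (F k) :=
  (seqNorm_mono hp fun n => enorm_fourierCoeff_le_tsum h n).trans (seqNorm_tsum_le hp _)

theorem algNorm_add_le (hp : 1 ≤ p) (f g : C(AddCircle T, ℂ)) :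
    algNorm p t (f + g) ≤ algNorm p t f + algNorm p t g := by
  refine (seqNorm_mono hp fun n => ?_).trans (seqNorm_add_le hp _ _)
  rw [← fourierCoeffCLM_apply, map_add]
  exact enorm_add_le _ _

theorem algNorm_smul (hp : 1 ≤ p) (c : ℂ) (f : C(AddCircle T, ℂ)) :
    algNorm p t (c • f) = ‖c‖ₑ * algNorm p t f := by
  unfold algNorm
  rw [← seqNorm_const_mul hp]
  congr 1
  funext n
  rw [← fourierCoeffCLM_apply, map_smul, smul_eq_mul, enorm_mul]
  rfl

theorem algNorm_sum_le (hp : 1 ≤ p) {κ : Type*} (S : Finset κ) (F : κ → C(AddCircle T, ℂ)) :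
    algNorm p t (∑ k ∈ S, F k) ≤ ∑ k ∈ S, algNorm p t (F k) := by
  classical
  induction S using Finset.induction_on with
  | empty =>
    have := algNorm_smul (t := t) hp 0 (0 : C(AddCircle T, ℂ))
    simpa using this.le
  | insert a S ha ih =>
    rw [Finset.sum_insert ha, Finset.sum_insert ha]
    exact (algNorm_add_le hp _ _).trans (by gcongr)

theorem summable_fourierCoeff {f : C(AddCircle T, ℂ)} (hf : algNorm p t f ≠ ⊤) :
    Summable (fourierCoeff f) :=
  .of_enorm (ne_top_of_le_ne_top hf (tsum_le_seqNorm _))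

/-- A finite norm makes the Fourier series absolutely convergent, and characters have sup norm `1`.
-/
theorem enorm_le_algNorm {f : C(AddCircle T, ℂ)} (hf : algNorm p t f ≠ ⊤) :
    ‖f‖ₑ ≤ algNorm p t f := by
  rw [← (hasSum_fourier_series_of_summable (summable_fourierCoeff hf)).tsum_eq]
  refine enorm_tsum_le_tsum_enorm.trans ((tsum_congr fun n => ?_).trans_le (tsum_le_seqNorm _))
  rw [(hasSum_fourier_series_of_summable (summable_fourierCoeff hf)).tsum_eq, enorm_smul,
    ← ofReal_norm (fourier n), fourier_norm]
  simp

/-- Only `f` is expanded into characters, each of which shifts the coefficients of `g`; hence `g`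
may be any continuous function. -/
theorem enorm_fourierCoeff_mul_le {f : C(AddCircle T, ℂ)} (hf : Summable (fourierCoeff f))
    (g : C(AddCircle T, ℂ)) (n : ℤ) : ‖fourierCoeff (f * g : C(AddCircle T, ℂ)) n‖ₑ ≤
      ∑' k, ‖fourierCoeff f k‖ₑ * ‖fourierCoeff g (n - k)‖ₑ := by
  refine (enorm_fourierCoeff_le_tsum
    ((hasSum_fourier_series_of_summable hf).mul_right g) n).trans_eq (tsum_congr fun k => ?_)
  rw [smul_mul_assoc, ← fourierCoeffCLM_apply, map_smul, fourierCoeffCLM_apply,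
    fourierCoeff_fourier_mul, smul_eq_mul, enorm_mul]

theorem algNorm_mul_le (hp : 1 ≤ p) (ht : 0 ≤ t) {f : C(AddCircle T, ℂ)}
    (hf : algNorm p t f ≠ ⊤) (g : C(AddCircle T, ℂ)) :
    algNorm p t (f * g) ≤ algNorm p t f * algNorm p t g :=
  (seqNorm_mono hp fun n => enorm_fourierCoeff_mul_le (summable_fourierCoeff hf) g n).trans
    (seqNorm_conv_le hp ht _ _)

/-- Each coefficient is bounded by the sup norm, so for a trigonometric polynomial the algebra norm
costs only a factor depending on its frequencies. -/
theorem algNorm_le_of_support (hp : 1 ≤ p) {f : C(AddCircle T, ℂ)} {S : Finset ℤ}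
    (hS : ∀ n ∉ S, fourierCoeff f n = 0) :
    algNorm p t f ≤ algConst t * (∑ n ∈ S, (1 + wt t n)) * ‖f‖ₑ := by
  refine (seqNorm_le_tsum hp _).trans ?_
  rw [tsum_eq_sum (s := S) (fun n hn => by simp [hS n hn]), mul_assoc, Finset.sum_mul]
  gcongr with n hn
  rw [← ofReal_norm, ← ofReal_norm]
  exact ENNReal.ofReal_le_ofReal (norm_fourierCoeff_le f n)

theorem algNorm_ne_top_of_support (hp : 1 ≤ p) {f : C(AddCircle T, ℂ)} {S : Finset ℤ}
    (hS : ∀ n ∉ S, fourierCoeff f n = 0) : algNorm p t f ≠ ⊤ := by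
  refine ne_top_of_le_ne_top ?_ (algNorm_le_of_support hp hS)
  refine ENNReal.mul_ne_top (ENNReal.mul_ne_top algConst_ne_top ?_) enorm_ne_top
  exact ENNReal.sum_ne_top.2 fun n _ => by simp [wt]

theorem algNorm_fourier_ne_top (hp : 1 ≤ p) (n : ℤ) :
    algNorm p t (fourier n : C(AddCircle T, ℂ)) ≠ ⊤ := by
  refine algNorm_ne_top_of_support hp (S := {n}) fun k hk => ?_
  rw [fourierCoeff_fourier, Pi.single_eq_of_ne (by simpa using hk)]

theorem algNorm_one_ne_top (hp : 1 ≤ p) : algNorm p t (1 : C(AddCircle T, ℂ)) ≠ ⊤ := by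
  have h : (1 : C(AddCircle T, ℂ)) = fourier 0 := by ext x; simp
  rw [h]
  exact algNorm_fourier_ne_top hp 0

variable (T) in
/-- The algebra of continuous functions on the circle whose sequence of Fourier coefficients `β`
satisfies `∑ |β n| < ∞` and `∑ (|n|^t |β n|)^p < ∞`. -/
def fourierAlg (hp : 1 ≤ p) (ht : 0 ≤ t) : Subalgebra ℂ C(AddCircle T, ℂ) where
  carrier := {f | algNorm p t f ≠ ⊤}
  mul_mem' {_ g} hf hg :=
    ne_top_of_le_ne_top (ENNReal.mul_ne_top hf hg) (algNorm_mul_le hp ht hf g)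
  add_mem' {f g} hf hg :=
    ne_top_of_le_ne_top (ENNReal.add_ne_top.2 ⟨hf, hg⟩) (algNorm_add_le hp f g)
  algebraMap_mem' c := by
    rw [Algebra.algebraMap_eq_smul_one, Set.mem_ofPred_eq, algNorm_smul hp]
    exact ENNReal.mul_ne_top enorm_ne_top (algNorm_one_ne_top hp)

theorem mem_fourierAlg {hp : 1 ≤ p} {ht : 0 ≤ t} {f : C(AddCircle T, ℂ)} :
    f ∈ fourierAlg T hp ht ↔ algNorm p t f ≠ ⊤ := Iff.rfl

/-- The unit does not have norm `1` here, hence the extra factor. -/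
theorem algNorm_pow_le (hp : 1 ≤ p) (ht : 0 ≤ t) {f : C(AddCircle T, ℂ)}
    (hf : algNorm p t f ≠ ⊤) (n : ℕ) :
    algNorm p t (f ^ n) ≤ algNorm p t (1 : C(AddCircle T, ℂ)) * algNorm p t f ^ n := by
  induction n with
  | zero => simp
  | succ n ih =>
    rw [pow_succ, pow_succ, ← mul_assoc]
    exact (algNorm_mul_le hp ht ((fourierAlg T hp ht).pow_mem hf n) f).trans (by gcongr)

/-! ### Density of trigonometric polynomials, spectral radius and Wiener's lemma. -/

theorem tendsto_ellNorm_indicator_compl {ι : Type*} {q : ℝ} (hq : 1 ≤ q) {F : ι → ℝ≥0∞}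
    (hF : ellNorm q F ≠ ⊤) :
    Tendsto (fun S : Finset ι => ellNorm q ((↑S : Set ι)ᶜ.indicator F)) atTop (𝓝 0) := by
  have hq0 : 0 < q := by linarith
  have h1 : ∑' n, F n ^ q ≠ ⊤ := by
    intro h
    apply hF
    rw [ellNorm, h, ENNReal.top_rpow_of_pos (by positivity)]
  have h2 := (ENNReal.continuous_rpow_const (y := 1 / q)).tendsto 0 |>.comp
    (ENNReal.tendsto_tsum_compl_atTop_zero h1)
  rw [ENNReal.zero_rpow_of_pos (by positivity)] at h2
  refine h2.congr fun S => ?_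
  unfold ellNorm
  simp only [Function.comp_apply]
  congr 1
  refine (tsum_subtype ((↑S : Set ι)ᶜ) (fun n => F n ^ q)).trans (tsum_congr fun n => ?_)
  by_cases h : n ∈ S <;> simp [h, hq0]

/-- Trigonometric polynomials are dense in the algebra. -/
theorem exists_trigPoly_algNorm_sub_lt (hp : 1 ≤ p) {f : C(AddCircle T, ℂ)}
    (hf : algNorm p t f ≠ ⊤) {ε : ℝ≥0∞} (hε : 0 < ε) :
    ∃ (P : C(AddCircle T, ℂ)) (S : Finset ℤ), (∀ n ∉ S, fourierCoeff P n = 0) ∧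
      algNorm p t (f - P) < ε := by
  classical
  set F : ℤ → ℝ≥0∞ := fun n => ‖fourierCoeff f n‖ₑ with hF
  have h0 : ∑' n, F n + ellNorm p (fun n => wt t n * F n) ≠ ⊤ := by
    intro h
    apply hf
    rw [algNorm, seqNorm, h, ENNReal.mul_top (one_pos.trans_le one_le_algConst).ne']
  obtain ⟨h1, h2⟩ := ENNReal.add_ne_top.1 h0
  have e1 : ∀ G : ℤ → ℝ≥0∞, ellNorm 1 G = ∑' n, G n := fun G => by simp [ellNorm]
  have t1 := tendsto_ellNorm_indicator_compl le_rfl (F := F) (by rwa [e1])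
  have t2 := tendsto_ellNorm_indicator_compl hp h2
  have t3 := ENNReal.Tendsto.const_mul (a := algConst t) (t1.add t2) (Or.inr algConst_ne_top)
  simp only [add_zero, mul_zero] at t3
  obtain ⟨S, hS⟩ := (t3.eventually (gt_mem_nhds hε)).exists
  have hc : ∀ n, fourierCoeff (∑ k ∈ S, fourierCoeff f k • fourier k : C(AddCircle T, ℂ)) n
      = if n ∈ S then fourierCoeff f n else 0 := by
    intro n
    rw [← fourierCoeffCLM_apply, map_sum]
    simp_rw [map_smul, fourierCoeffCLM_apply, fourierCoeff_fourier]
    simp [Pi.single_apply]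
  refine ⟨∑ k ∈ S, fourierCoeff f k • fourier k, S, fun n hn => by rw [hc, if_neg hn], ?_⟩
  refine lt_of_eq_of_lt ?_ hS
  have e2 : ∀ n, ‖fourierCoeff (f - ∑ k ∈ S, fourierCoeff f k • fourier k : C(AddCircle T, ℂ)) n‖ₑ
      = (↑S : Set ℤ)ᶜ.indicator F n := by
    intro n
    rw [← fourierCoeffCLM_apply, map_sub, fourierCoeffCLM_apply, fourierCoeffCLM_apply, hc]
    by_cases h : n ∈ S <;> simp [h, hF]
  unfold algNorm seqNorm
  simp_rw [e2]
  rw [e1]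
  congr 3
  funext n
  by_cases h : n ∈ S <;> simp [h]

theorem fourierCoeff_mul_eq_zero {f g : C(AddCircle T, ℂ)} {a b : ℕ}
    (hf : ∀ n ∉ Finset.Icc (-a : ℤ) a, fourierCoeff f n = 0)
    (hg : ∀ n ∉ Finset.Icc (-b : ℤ) b, fourierCoeff g n = 0) :
    ∀ n ∉ Finset.Icc (-(a + b : ℕ) : ℤ) (a + b : ℕ),
      fourierCoeff (f * g : C(AddCircle T, ℂ)) n = 0 := by
  intro n hn
  have hs : Summable (fourierCoeff f) := summable_of_ne_finset_zero hf
  have h := enorm_fourierCoeff_mul_le hs g n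
  have h0 : ∀ k, ‖fourierCoeff f k‖ₑ * ‖fourierCoeff g (n - k)‖ₑ = 0 := by
    intro k
    by_cases hk : k ∈ Finset.Icc (-a : ℤ) a
    · rw [hg (n - k) ?_]
      · simp
      · simp only [Finset.mem_Icc, not_and, not_le] at hk hn ⊢
        omega
    · rw [hf k hk]
      simp
  simpa [h0] using h

theorem fourierCoeff_pow_eq_zero {f : C(AddCircle T, ℂ)} {a : ℕ}
    (hf : ∀ n ∉ Finset.Icc (-a : ℤ) a, fourierCoeff f n = 0) (m : ℕ) :
    ∀ n ∉ Finset.Icc (-(m * a : ℕ) : ℤ) (m * a : ℕ),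
      fourierCoeff (f ^ m : C(AddCircle T, ℂ)) n = 0 := by
  induction m with
  | zero =>
    intro n hn
    have h : (1 : C(AddCircle T, ℂ)) = fourier 0 := by ext x; simp
    rw [pow_zero, h, fourierCoeff_fourier, Pi.single_eq_of_ne]
    rintro rfl
    simp at hn
  | succ m ih =>
    rw [pow_succ, Nat.succ_mul]
    exact fourierCoeff_mul_eq_zero ih hf

/-- The exact power is immaterial: polynomial growth in the degree is beaten by geometric decay in
`exists_mul_pow_mul_pow_lt_one`. -/
theorem sum_one_add_wt_le {t : ℝ} {J : ℕ} (ht : 0 ≤ t) (hJ : t ≤ J) (D : ℕ) :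
    ∑ n ∈ Finset.Icc (-D : ℤ) D, (1 + wt t n) ≤ ((2 * D + 2 : ℕ) : ℝ≥0∞) ^ (J + 2) := by
  have h1 : ∀ n ∈ Finset.Icc (-D : ℤ) D, 1 + wt t n ≤ ((2 * D + 2 : ℕ) : ℝ≥0∞) ^ (J + 1) := by
    intro n hn
    have hn' : |(n : ℝ)| ≤ D := by
      rw [Finset.mem_Icc] at hn
      exact abs_le.2 ⟨by exact_mod_cast hn.1, by exact_mod_cast hn.2⟩
    have h2 : |(n : ℝ)| ^ t ≤ ((D : ℝ) + 1) ^ J := by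
      rw [← Real.rpow_natCast]
      exact (Real.rpow_le_rpow (abs_nonneg _) (hn'.trans (by linarith)) ht).trans
        (Real.rpow_le_rpow_of_exponent_le (by linarith [Nat.cast_nonneg (α := ℝ) D]) hJ)
    have h3 : 1 + |(n : ℝ)| ^ t ≤ ((2 * D + 2 : ℕ) : ℝ) ^ (J + 1) := by
      have h4 : (1 : ℝ) ≤ ((D : ℝ) + 1) ^ J := one_le_pow₀ (by linarith [Nat.cast_nonneg (α := ℝ) D])
      have h5 : ((D : ℝ) + 1) ^ J ≤ ((2 * D + 2 : ℕ) : ℝ) ^ J := by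
        push_cast
        gcongr <;> linarith [Nat.cast_nonneg (α := ℝ) D]
      have h6 : (2 : ℝ) ≤ ((2 * D + 2 : ℕ) : ℝ) := by
        push_cast
        linarith [Nat.cast_nonneg (α := ℝ) D]
      rw [pow_succ]
      nlinarith
    calc 1 + wt t n = ENNReal.ofReal (1 + |(n : ℝ)| ^ t) := by
          rw [ENNReal.ofReal_add zero_le_one (by positivity), ENNReal.ofReal_one, wt]
      _ ≤ ENNReal.ofReal (((2 * D + 2 : ℕ) : ℝ) ^ (J + 1)) := ENNReal.ofReal_le_ofReal h3
      _ = _ := by rw [ENNReal.ofReal_pow (by positivity), ENNReal.ofReal_natCast]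
  refine (Finset.sum_le_card_nsmul _ _ _ h1).trans ?_
  rw [Int.card_Icc, nsmul_eq_mul, pow_succ' _ (J + 1)]
  gcongr
  omega

theorem exists_mul_pow_mul_pow_lt_one {C q : ℝ≥0∞} (hC : C ≠ ⊤) (hq : q < 1) (k : ℕ) :
    ∃ m : ℕ, C * ((m + 1 : ℕ) : ℝ≥0∞) ^ k * q ^ m < 1 := by
  lift C to NNReal using hC
  lift q to NNReal using hq.ne_top
  rcases eq_or_ne q 0 with rfl | hq0
  · exact ⟨1, by simp⟩
  have hq1 : (q : ℝ) < 1 := by exact_mod_cast hq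
  have h := ((tendsto_pow_const_mul_const_pow_of_lt_one k (NNReal.coe_nonneg q) hq1).comp
    (tendsto_add_atTop_nat 1)).const_mul ((C : ℝ) / q)
  rw [mul_zero] at h
  obtain ⟨m, hm⟩ := (h.eventually (gt_mem_nhds one_pos)).exists
  refine ⟨m, ?_⟩
  have hq0' : (q : ℝ) ≠ 0 := by exact_mod_cast hq0
  have e : (C : ℝ) / q * (((m + 1 : ℕ) : ℝ) ^ k * (q : ℝ) ^ (m + 1))
      = C * ((m + 1 : ℕ) : ℝ) ^ k * (q : ℝ) ^ m := by
    field_simp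
    ring
  simp only [Function.comp_apply] at hm
  rw [e] at hm
  exact_mod_cast hm

/-- The spectral radius in the algebra is at most the supremum norm. -/
theorem exists_algNorm_pow_lt_one (hp : 1 ≤ p) (ht : 0 ≤ t) {u : C(AddCircle T, ℂ)}
    (hu : algNorm p t u ≠ ⊤) (hu1 : ‖u‖ < 1) : ∃ m : ℕ, algNorm p t (u ^ m) < 1 := by
  have hu1' : ‖u‖ₑ < 1 := by
    rw [← ofReal_norm, ← ENNReal.ofReal_one]
    exact (ENNReal.ofReal_lt_ofReal_iff one_pos).2 hu1
  -- One `ε` pays for `‖P‖ ≤ ‖u‖ + ε`, the other for the algebra norm of the remainder `u - P`.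
  obtain ⟨ε, hε0, hε⟩ : ∃ ε : ℝ≥0∞, 0 < ε ∧ ‖u‖ₑ + (ε + ε) < 1 := by
    have hc : Tendsto (fun ε : ℝ≥0∞ => ‖u‖ₑ + (ε + ε)) (𝓝[>] 0) (𝓝 (‖u‖ₑ + (0 + 0))) :=
      (Continuous.tendsto (by fun_prop) _).mono_left nhdsWithin_le_nhds
    rw [add_zero, add_zero] at hc
    obtain ⟨ε, h1, h2⟩ := ((hc.eventually (gt_mem_nhds hu1')).and self_mem_nhdsWithin).exists
    exact ⟨ε, h2, h1⟩
  obtain ⟨P, S, hS, hP⟩ := exists_trigPoly_algNorm_sub_lt hp hu hε0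
  obtain ⟨d, hd⟩ : ∃ d : ℕ, ∀ n ∉ Finset.Icc (-d : ℤ) d, fourierCoeff P n = 0 := by
    refine ⟨S.sup Int.natAbs, fun n hn => hS n fun hnS => hn ?_⟩
    have := Finset.le_sup (f := Int.natAbs) hnS
    rw [Finset.mem_Icc]
    omega
  set v := u - P with hv
  have hv0 : algNorm p t v ≠ ⊤ := hP.ne_top
  have hPu : ‖P‖ₑ ≤ ‖u‖ₑ + ε := by
    have : P = u - v := by simp [hv]
    rw [this]
    exact enorm_sub_le.trans (by gcongr; exact (enorm_le_algNorm hv0).trans hP.le)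
  set q := ‖P‖ₑ + algNorm p t v with hq
  have hq1 : q < 1 := lt_of_le_of_lt (by rw [hq, ← add_assoc]; gcongr) hε
  obtain ⟨J, hJ⟩ := exists_nat_ge t
  have hPk : ∀ k m : ℕ, k ≤ m → algNorm p t (P ^ k) ≤
      algConst t * ((2 * d + 2 : ℕ) * (m + 1 : ℕ) : ℝ≥0∞) ^ (J + 2) * ‖P‖ₑ ^ k := by
    intro k m hkm
    refine (algNorm_le_of_support hp (fourierCoeff_pow_eq_zero hd k)).trans ?_
    have h1 : ‖P ^ k‖ₑ ≤ ‖P‖ₑ ^ k := by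
      rw [← ofReal_norm, ← ofReal_norm, ← ENNReal.ofReal_pow (norm_nonneg _)]
      exact ENNReal.ofReal_le_ofReal (norm_pow_le _ _)
    gcongr
    refine (sum_one_add_wt_le ht hJ _).trans ?_
    gcongr
    norm_cast
    nlinarith
  set C := algConst t * ((2 * d + 2 : ℕ) : ℝ≥0∞) ^ (J + 2) * algNorm p t (1 : C(AddCircle T, ℂ))
  have hC : C ≠ ⊤ := ENNReal.mul_ne_top (ENNReal.mul_ne_top algConst_ne_top
    (ENNReal.pow_ne_top (ENNReal.natCast_ne_top _))) (algNorm_one_ne_top hp)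
  obtain ⟨m, hm⟩ := exists_mul_pow_mul_pow_lt_one hC hq1 (J + 2)
  refine ⟨m, lt_of_le_of_lt ?_ hm⟩
  -- In the binomial expansion, powers of `P` are estimated in sup norm up to a polynomial factor in
  -- `m`, powers of `v` in algebra norm. The sum collapses to a polynomial in `m` times `q ^ m` with
  -- `q < 1`.
  have hsum : u ^ m = ∑ k ∈ Finset.range (m + 1), (m.choose k : ℂ) • (P ^ k * v ^ (m - k)) := by
    rw [show u = P + v by simp [hv], add_pow]
    refine Finset.sum_congr rfl fun k _ => ?_
    rw [mul_comm, Nat.cast_smul_eq_nsmul, nsmul_eq_mul]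
  have hle : algNorm p t (u ^ m) ≤ ∑ k ∈ Finset.range (m + 1),
      algNorm p t ((m.choose k : ℂ) • (P ^ k * v ^ (m - k))) := by
    rw [hsum]
    exact algNorm_sum_le hp _ _
  refine hle.trans ?_
  calc _ ≤ ∑ k ∈ Finset.range (m + 1), C * ((m + 1 : ℕ) : ℝ≥0∞) ^ (J + 2) *
        (‖P‖ₑ ^ k * algNorm p t v ^ (m - k) * m.choose k) := by
        refine Finset.sum_le_sum fun k hk => ?_
        rw [algNorm_smul hp]
        have h1 := hPk k m (Nat.lt_succ_iff.1 (Finset.mem_range.1 hk))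
        have h2 := algNorm_pow_le hp ht hv0 (m - k)
        have h3 : ‖(m.choose k : ℂ)‖ₑ = (m.choose k : ℝ≥0∞) := by
          rw [← ofReal_norm, Complex.norm_natCast, ENNReal.ofReal_natCast]
        rw [h3]
        calc _ ≤ (m.choose k : ℝ≥0∞) * (algNorm p t (P ^ k) * algNorm p t (v ^ (m - k))) := by
              gcongr
              exact algNorm_mul_le hp ht
                (algNorm_ne_top_of_support hp (fourierCoeff_pow_eq_zero hd k)) _
          _ ≤ (m.choose k : ℝ≥0∞) * ((algConst t *
                ((2 * d + 2 : ℕ) * (m + 1 : ℕ) : ℝ≥0∞) ^ (J + 2) * ‖P‖ₑ ^ k) *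
                (algNorm p t 1 * algNorm p t v ^ (m - k))) := by gcongr
          _ = _ := by
              rw [mul_pow]
              ring
    _ = _ := by rw [← Finset.mul_sum, ← add_pow]

/-- The geometric series converges uniformly, and countable subadditivity bounds the algebra norm of
its sum; completeness of the algebra is not needed. -/
theorem exists_one_sub_mul_eq_one_of_algNorm_lt_one (hp : 1 ≤ p) (ht : 0 ≤ t)
    {w : C(AddCircle T, ℂ)} (hw : algNorm p t w < 1) :
    ∃ g ∈ fourierAlg T hp ht, (1 - w) * g = 1 := by
  have hw1 : ‖w‖ < 1 := by
    have := (enorm_le_algNorm hw.ne_top).trans_lt hw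
    rw [← ofReal_norm, ← ENNReal.ofReal_one] at this
    exact (ENNReal.ofReal_lt_ofReal_iff one_pos).1 this
  refine ⟨∑' n, w ^ n, ?_, mul_neg_geom_series w hw1⟩
  have h1 := algNorm_le_tsum (t := t) hp (summable_geometric_of_norm_lt_one hw1).hasSum
  refine mem_fourierAlg.2 (ne_top_of_le_ne_top ?_
    (h1.trans (ENNReal.tsum_le_tsum fun n => algNorm_pow_le hp ht hw.ne_top n)))
  rw [ENNReal.tsum_mul_left, ENNReal.tsum_geometric]
  exact ENNReal.mul_ne_top (algNorm_one_ne_top hp) (by simpa [tsub_eq_zero_iff_le] using hw)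

/-- **Wiener's lemma** for functions close to `1`. -/
theorem exists_one_sub_mul_eq_one (hp : 1 ≤ p) (ht : 0 ≤ t) {u : C(AddCircle T, ℂ)}
    (hu : u ∈ fourierAlg T hp ht) (hu1 : ‖u‖ < 1) :
    ∃ g ∈ fourierAlg T hp ht, (1 - u) * g = 1 := by
  obtain ⟨m, hm⟩ := exists_algNorm_pow_lt_one hp ht hu hu1
  obtain ⟨g, hg, hg1⟩ := exists_one_sub_mul_eq_one_of_algNorm_lt_one hp ht hm
  -- `1 - u` divides `1 - u ^ m`, which is invertible since `u ^ m` has algebra norm below `1`.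
  refine ⟨(∑ i ∈ Finset.range m, u ^ i) * g,
    mul_mem (sum_mem fun i _ => pow_mem hu i) hg, ?_⟩
  rw [← mul_assoc, mul_neg_geom_sum, hg1]

end FourierAlgebra

/-! ### Smooth functions and cutoffs. -/

theorem summable_iff_tsum_ofReal_ne_top {ι : Type*} {f : ι → ℝ} (hf : ∀ n, 0 ≤ f n) :
    Summable f ↔ ∑' n, ENNReal.ofReal (f n) ≠ ⊤ := by
  refine ⟨fun h => h.tsum_ofReal_ne_top, fun h => ?_⟩
  simpa [ENNReal.toReal_ofReal, hf] using ENNReal.summable_toReal h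

/-- The Fourier coefficients of a smooth periodic function decay faster than any power. -/
theorem exists_pow_mul_norm_fourierCoeffOn_le {T : ℝ} (hT : 0 < T) (j : ℕ) :
    ∀ g : ℝ → ℂ, ContDiff ℝ ∞ g → Function.Periodic g T →
      ∃ C, ∀ n : ℤ, |(n : ℝ)| ^ j * ‖fourierCoeffOn hT g n‖ ≤ C := by
  induction j with
  | zero =>
    intro g hg _
    obtain ⟨C, hC⟩ := isCompact_Icc.exists_bound_of_continuousOn (s := Icc 0 T)
      hg.continuous.continuousOn
    refine ⟨1 / T * (C * T), fun n => ?_⟩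
    rw [pow_zero, one_mul, fourierCoeffOn_eq_integral, norm_smul, sub_zero, Real.norm_eq_abs,
      abs_of_pos (by positivity)]
    gcongr
    refine (intervalIntegral.norm_integral_le_of_norm_le_const (C := C) fun x hx => ?_).trans ?_
    · rw [norm_smul, fourier_apply, Circle.norm_coe, one_mul]
      rw [uIoc_of_le hT.le] at hx
      exact hC x ⟨hx.1.le, hx.2⟩
    · rw [sub_zero, abs_of_pos hT]
  | succ j ih =>
    intro g hg hper
    have hd : ContDiff ℝ ∞ (deriv g) := (contDiff_infty_iff_deriv.1 hg).2
    have hdper : Function.Periodic (deriv g) T := fun x => by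
      rw [← deriv_comp_add_const]
      exact congrArg (deriv · x) (funext hper)
    obtain ⟨C, hC⟩ := ih _ hd hdper
    refine ⟨T * C, fun n => ?_⟩
    have hC0 : 0 ≤ C := le_trans (by positivity) (hC 0)
    rcases eq_or_ne n 0 with rfl | hn
    · simp only [Int.cast_zero, abs_zero, ne_eq, Nat.succ_ne_zero, not_false_eq_true, zero_pow,
        zero_mul]
      positivity
    -- Integration by parts gains a factor `T / (2π|n|)`; the boundary term vanishes by periodicity.
    have h := fourierCoeffOn_of_hasDerivAt hT hn (f := g) (f' := deriv g)
      (fun x _ => ((contDiff_infty_iff_deriv.1 hg).1 x).hasDerivAt)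
      (hd.continuous.intervalIntegrable _ _)
    have h0 : g T - g 0 = 0 := by
      rw [sub_eq_zero]
      simpa using hper 0
    rw [h0, mul_zero, zero_sub, Complex.ofReal_zero, sub_zero] at h
    have hn0 : 0 < |(n : ℝ)| := abs_pos.2 (by exact_mod_cast hn)
    have hnorm : ‖fourierCoeffOn hT g n‖ =
        1 / (2 * Real.pi * |(n : ℝ)|) * (T * ‖fourierCoeffOn hT (deriv g) n‖) := by
      rw [h]
      simp [abs_of_pos hT, abs_of_pos Real.pi_pos]
    have hpi : 1 ≤ 2 * Real.pi := by linarith [Real.pi_gt_three]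
    rw [hnorm]
    calc |(n : ℝ)| ^ (j + 1) * (1 / (2 * Real.pi * |(n : ℝ)|) *
          (T * ‖fourierCoeffOn hT (deriv g) n‖))
        = 1 / (2 * Real.pi) * (T * (|(n : ℝ)| ^ j * ‖fourierCoeffOn hT (deriv g) n‖)) := by
          field_simp
          ring
      _ ≤ 1 * (T * C) := by
          gcongr
          · rw [div_le_one (by positivity)]
            exact hpi
          · exact hC n
      _ = T * C := one_mul _

section Smooth
variable {T : ℝ} [hT : Fact (0 < T)] {p t : ℝ}

theorem fourierCoeffOn_comp_coe (f : AddCircle T → ℂ) (n : ℤ) :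
    fourierCoeffOn hT.out (fun x => f x) n = fourierCoeff f n := by
  rw [fourierCoeffOn_eq_integral, fourierCoeff_eq_intervalIntegral f n 0]
  simp only [fourier_coe_apply, sub_zero, zero_add]

/-- Smooth functions belong to the algebra. -/
theorem mem_fourierAlg_of_contDiff (hp : 1 ≤ p) (ht : 0 ≤ t) {f : C(AddCircle T, ℂ)}
    (hf : ContDiff ℝ ∞ fun x : ℝ => f x) : f ∈ fourierAlg T hp ht := by
  obtain ⟨J, hJ⟩ := exists_nat_ge t
  -- `J ≥ t` powers absorb the weight, and two more leave the summable `1 / n²`.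
  obtain ⟨C, hC⟩ := exists_pow_mul_norm_fourierCoeffOn_le hT.out (J + 2) _ hf
    (fun x => by rw [AddCircle.coe_add_period])
  have hC' : ∀ n : ℤ, |(n : ℝ)| ^ (J + 2) * ‖fourierCoeff f n‖ ≤ C := fun n => by
    rw [← fourierCoeffOn_comp_coe]
    exact hC n
  have hs : Summable fun n : ℤ => (1 + |(n : ℝ)| ^ t) * ‖fourierCoeff f n‖ := by
    refine Summable.of_norm_bounded_eventually
      (g := fun n : ℤ => 2 * C * (1 / (n : ℝ) ^ 2)) ?_ ?_
    · exact (Real.summable_one_div_int_pow.2 (by norm_num)).mul_left _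
    · filter_upwards [(Set.finite_singleton (0 : ℤ)).eventually_cofinite_notMem] with n hn
      have hn1 : 1 ≤ |(n : ℝ)| := by exact_mod_cast Int.one_le_abs hn
      have h1 : |(n : ℝ)| ^ t ≤ |(n : ℝ)| ^ J := by
        rw [← Real.rpow_natCast]
        exact Real.rpow_le_rpow_of_exponent_le hn1 hJ
      have h2 : 1 ≤ |(n : ℝ)| ^ J := one_le_pow₀ hn1
      rw [Real.norm_of_nonneg (by positivity), mul_one_div, ← sq_abs,
        le_div_iff₀ (by positivity)]
      calc _ ≤ (|(n : ℝ)| ^ J + |(n : ℝ)| ^ J) * ‖fourierCoeff f n‖ * |(n : ℝ)| ^ 2 := by gcongr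
        _ = 2 * (|(n : ℝ)| ^ (J + 2) * ‖fourierCoeff f n‖) := by ring
        _ ≤ 2 * C := by gcongr; exact hC' n
  refine mem_fourierAlg.2 (ne_top_of_le_ne_top ?_ (seqNorm_le_tsum hp _))
  refine ENNReal.mul_ne_top algConst_ne_top ?_
  convert hs.tsum_ofReal_ne_top using 4 with n
  rw [ENNReal.ofReal_mul (by positivity), ENNReal.ofReal_add zero_le_one (by positivity), wt,
    ENNReal.ofReal_one, ofReal_norm]

end Smooth

/-- Smooth cutoff functions exist. -/
theorem exists_isSmoothBump (θ₀ : Real.Angle) {U : Set Real.Angle} (hU : U ∈ 𝓝 θ₀) :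
    ∃ χ : Real.Angle → ℝ, IsSmoothBump χ ∧ (∀ᶠ θ in 𝓝 θ₀, χ θ = 1) ∧ tsupport χ ⊆ U := by
  have : CompactSpace Real.Angle := inferInstanceAs (CompactSpace (AddCircle (2 * Real.pi)))
  have hcos : Continuous fun θ : Real.Angle => (θ - θ₀).cos :=
    Real.Angle.continuous_cos.comp (continuous_id.sub continuous_const)
  -- `cos (θ - θ₀)` equals `1` only at `θ₀`, so by compactness its maximum off the interior of `U`
  -- is below `1`.
  obtain ⟨c, hc1, hc⟩ : ∃ c < 1, ∀ θ : Real.Angle, c ≤ (θ - θ₀).cos → θ ∈ U := by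
    have hK : IsCompact (interior U)ᶜ := isOpen_interior.isClosed_compl.isCompact
    rcases (interior U)ᶜ.eq_empty_or_nonempty with he | hne
    · exact ⟨0, one_pos, fun θ _ => interior_subset (by
        rw [compl_empty_iff] at he
        rw [he]
        trivial)⟩
    · obtain ⟨θ₁, h1, hmax⟩ := hK.exists_isMaxOn hne hcos.continuousOn
      have hlt : (θ₁ - θ₀).cos < 1 := by
        refine lt_of_le_of_ne ?_ fun h => h1 ?_
        · induction θ₁ - θ₀ using Real.Angle.induction_on with
          | _ x => exact Real.cos_le_one x
        · have h2 : (θ₁ - θ₀).sin = 0 := by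
            have := Real.Angle.cos_sq_add_sin_sq (θ₁ - θ₀)
            rw [h] at this
            nlinarith
          rcases Real.Angle.sin_eq_zero_iff.1 h2 with h3 | h3
          · rw [sub_eq_zero.1 h3]
            exact mem_interior_iff_mem_nhds.2 hU
          · rw [h3, Real.Angle.cos_coe_pi] at h
            norm_num at h
      refine ⟨((θ₁ - θ₀).cos + 1) / 2, by linarith, fun θ hθ => interior_subset ?_⟩
      by_contra hcon
      have := hmax hcon
      simp only [Set.mem_ofPred_eq] at this
      linarith
  -- The rescaling gives `0` where the cosine is at most `c` and `1` where it is at least `(1 + c) /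
  -- 2`.
  refine ⟨fun θ => Real.smoothTransition (2 * ((θ - θ₀).cos - c) / (1 - c)), ⟨?_, fun θ =>
    ⟨Real.smoothTransition.nonneg _, Real.smoothTransition.le_one _⟩⟩, ?_, ?_⟩
  · refine Real.smoothTransition.contDiff.comp ?_
    induction θ₀ using Real.Angle.induction_on with
    | _ x =>
      simp only [← Real.Angle.coe_sub, Real.Angle.cos_coe]
      have : ContDiff ℝ ∞ fun t : ℝ => Real.cos (t - x) :=
        Real.contDiff_cos.comp (contDiff_id.sub contDiff_const)
      exact ((contDiff_const.mul (this.sub contDiff_const)).div_const _)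
  · have h0 : (1 + c) / 2 < (θ₀ - θ₀).cos := by
      rw [sub_self, Real.Angle.cos_zero]
      linarith
    filter_upwards [hcos.continuousAt.eventually (lt_mem_nhds h0)] with θ hθ
    refine Real.smoothTransition.one_of_one_le ?_
    rw [le_div_iff₀ (by linarith)]
    linarith
  · have hcl : IsClosed {θ : Real.Angle | c ≤ (θ - θ₀).cos} := isClosed_le continuous_const hcos
    refine (closure_minimal (fun θ hθ => ?_) hcl).trans hc
    by_contra hcon
    refine hθ (Real.smoothTransition.zero_of_nonpos ?_)
    simp only [Set.mem_ofPred_eq, not_le] at hcon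
    exact div_nonpos_of_nonpos_of_nonneg (by linarith) (by linarith)

/-! ### Identification of the sequence spaces with the normed algebra. -/

theorem mem_wlp_iff_ellNorm_ne_top {p s : ℝ} (hp : 1 ≤ p) (β : ℤ → ℂ) :
    β ∈ wlp p s ↔ ellNorm p (fun n => wt (s / p) n * ‖β n‖ₑ) ≠ ⊤ := by
  have hp0 : 0 < p := by linarith
  rw [wlp, Set.mem_ofPred_eq, summable_iff_tsum_ofReal_ne_top (fun n => by positivity), ellNorm]
  have h : ∀ n : ℤ, ENNReal.ofReal (|(n : ℝ)| ^ s * ‖β n‖ ^ p) = (wt (s / p) n * ‖β n‖ₑ) ^ p := by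
    intro n
    rw [ENNReal.mul_rpow_of_nonneg _ _ hp0.le, wt,
      ENNReal.ofReal_rpow_of_nonneg (by positivity) hp0.le, ← Real.rpow_mul (abs_nonneg _),
      div_mul_cancel₀ _ hp0.ne', ENNReal.ofReal_mul (by positivity), ← ofReal_norm,
      ENNReal.ofReal_rpow_of_nonneg (norm_nonneg _) hp0.le]
  simp_rw [h]
  rw [not_iff_not, ENNReal.rpow_eq_top_iff_of_pos (by positivity)]

theorem mem_wlp_inter_iff_seqNorm_ne_top {p s : ℝ} (hp : 1 ≤ p) (β : ℤ → ℂ) :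
    β ∈ wlp p s ∩ wlp 1 0 ↔ seqNorm p (s / p) (fun n => ‖β n‖ₑ) ≠ ⊤ := by
  have h : β ∈ wlp 1 0 ↔ ∑' n, ‖β n‖ₑ ≠ ⊤ := by
    rw [mem_wlp_iff_ellNorm_ne_top le_rfl]
    simp [ellNorm, wt]
  rw [Set.mem_inter_iff, mem_wlp_iff_ellNorm_ne_top hp, h, seqNorm]
  constructor
  · rintro ⟨h1, h2⟩
    exact ENNReal.mul_ne_top algConst_ne_top (ENNReal.add_ne_top.2 ⟨h2, h1⟩)
  · intro h3
    refine (ENNReal.add_ne_top.1 fun h4 => h3 ?_).symm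
    rw [h4, ENNReal.mul_top (one_pos.trans_le one_le_algConst).ne']

theorem wlp_one_subset {s : ℝ} (hs : 0 ≤ s) : wlp 1 s ⊆ wlp 1 0 := by
  intro β hβ
  refine Summable.of_norm_bounded_eventually hβ ?_
  filter_upwards [(Set.finite_singleton (0 : ℤ)).eventually_cofinite_notMem] with n hn
  have hn1 : 1 ≤ |(n : ℝ)| := by exact_mod_cast Int.one_le_abs hn
  rw [Real.norm_of_nonneg (by positivity)]
  gcongr

/-- Both families have the form `wlp p s ∩ wlp 1 0`, with `(p, s)` equal to `(2, 1)` or `(1, s)`;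
the `p`-th root of the weight is `|n|^(s/p)`, so `t = s / p`. -/
theorem IsSeqAlgebra.exists_inAlg_iff {A : Set (ℤ → ℂ)} (hA : IsSeqAlgebra A) :
    ∃ (p t : ℝ) (hp : 1 ≤ p) (ht : 0 ≤ t), ∀ f : Real.Angle → ℂ,
      InAlg A f ↔ ∃ F ∈ fourierAlg (2 * Real.pi) hp ht, (F : AddCircle (2 * Real.pi) → ℂ) = f := by
  obtain ⟨p, s, hp, hs, rfl⟩ : ∃ p s : ℝ, 1 ≤ p ∧ 0 ≤ s ∧ A = wlp p s ∩ wlp 1 0 := by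
    rcases hA with rfl | ⟨s, hs, rfl⟩
    · exact ⟨2, 1, by norm_num, by norm_num, rfl⟩
    · have hs0 : 0 ≤ s := by linarith
      exact ⟨1, s, le_rfl, hs0, (Set.inter_eq_left.2 (wlp_one_subset hs0)).symm⟩
  refine ⟨p, s / p, hp, by positivity, fun f => ?_⟩
  unfold InAlg
  simp only [mem_wlp_inter_iff_seqNorm_ne_top hp]
  constructor
  · rintro ⟨h1, h2⟩
    exact ⟨⟨f, h1⟩, h2, rfl⟩
  · rintro ⟨F, h1, rfl⟩
    exact ⟨F.continuous, h1⟩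

/-! ### Germs of the algebra and the local Wiener lemma. -/

section InAlg
variable {A : Set (ℤ → ℂ)}

theorem InAlg.mul (hA : IsSeqAlgebra A) {f g : Real.Angle → ℂ} (hf : InAlg A f)
    (hg : InAlg A g) : InAlg A (fun θ => f θ * g θ) := by
  obtain ⟨p, t, hp, ht, h⟩ := hA.exists_inAlg_iff
  rw [h] at hf hg ⊢
  obtain ⟨F, hF, rfl⟩ := hf
  obtain ⟨G, hG, rfl⟩ := hg
  exact ⟨F * G, mul_mem hF hG, rfl⟩

theorem InAlg.add (hA : IsSeqAlgebra A) {f g : Real.Angle → ℂ} (hf : InAlg A f)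
    (hg : InAlg A g) : InAlg A (fun θ => f θ + g θ) := by
  obtain ⟨p, t, hp, ht, h⟩ := hA.exists_inAlg_iff
  rw [h] at hf hg ⊢
  obtain ⟨F, hF, rfl⟩ := hf
  obtain ⟨G, hG, rfl⟩ := hg
  exact ⟨F + G, add_mem hF hG, rfl⟩

theorem inAlg_of_contDiff (hA : IsSeqAlgebra A) {f : Real.Angle → ℂ}
    (hf : ContDiff ℝ ∞ fun x : ℝ => f x) : InAlg A f := by
  obtain ⟨p, t, hp, ht, h⟩ := hA.exists_inAlg_iff
  have hc : Continuous f := continuous_coinduced_dom.2 hf.continuous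
  rw [h]
  exact ⟨⟨f, hc⟩, mem_fourierAlg_of_contDiff hp ht hf, rfl⟩

theorem inAlg_const (hA : IsSeqAlgebra A) (c : ℂ) : InAlg A (fun _ => c) :=
  inAlg_of_contDiff hA contDiff_const

theorem IsSmoothBump.inAlg (hA : IsSeqAlgebra A) {χ : Real.Angle → ℝ} (hχ : IsSmoothBump χ) :
    InAlg A (fun θ => (χ θ : ℂ)) :=
  inAlg_of_contDiff hA (Complex.ofRealCLM.contDiff.comp hχ.1)

/-- A local version of **Wiener's lemma**. -/
theorem InAlg.exists_local_inverse (hA : IsSeqAlgebra A) {g : Real.Angle → ℂ} (hg : InAlg A g)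
    {θ₀ : Real.Angle} (h0 : g θ₀ ≠ 0) :
    ∃ h : Real.Angle → ℂ, InAlg A h ∧ ∀ᶠ θ in 𝓝 θ₀, g θ * h θ = 1 := by
  have hU : {θ | ‖g θ - g θ₀‖ < ‖g θ₀‖ / 2} ∈ 𝓝 θ₀ := by
    have hc : Continuous fun θ => ‖g θ - g θ₀‖ := (hg.1.sub continuous_const).norm
    refine hc.continuousAt.eventually (gt_mem_nhds ?_)
    simpa using h0
  obtain ⟨χ, hχ, hχ1, hχU⟩ := exists_isSmoothBump θ₀ hU
  -- This is `u = -χ (g - g θ₀) / g θ₀`: its sup norm is at most `1 / 2`, and `1 - u = g / g θ₀`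
  -- wherever `χ = 1`.
  have hu : InAlg A fun θ => (-(g θ₀)⁻¹) * ((χ θ : ℂ) * (g θ + -g θ₀)) :=
    (inAlg_const hA _).mul hA ((hχ.inAlg hA).mul hA (hg.add hA (inAlg_const hA _)))
  obtain ⟨p, t, hp, ht, hiff⟩ := hA.exists_inAlg_iff
  obtain ⟨u, hu, hu'⟩ := (hiff _).1 hu
  have hnorm : ‖u‖ < 1 := by
    refine lt_of_le_of_lt ((ContinuousMap.norm_le _ (by norm_num)).2 fun θ => ?_)
      (by norm_num : (1 / 2 : ℝ) < 1)
    rw [congrFun hu' θ, norm_mul, norm_neg, norm_inv, norm_mul, Complex.norm_real,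
      Real.norm_of_nonneg (hχ.2 θ).1, ← sub_eq_add_neg]
    by_cases hθ : χ θ = 0
    · simp [hθ]
    · have h1 : ‖g θ - g θ₀‖ < ‖g θ₀‖ / 2 := hχU (subset_tsupport _ hθ)
      have h2 : 0 < ‖g θ₀‖ := norm_pos_iff.2 h0
      calc ‖g θ₀‖⁻¹ * (χ θ * ‖g θ - g θ₀‖) ≤ ‖g θ₀‖⁻¹ * (1 * (‖g θ₀‖ / 2)) := by
            gcongr
            exact (hχ.2 θ).2
        _ = 1 / 2 := by field_simp
  obtain ⟨k, hk, hk1⟩ := exists_one_sub_mul_eq_one hp ht hu hnorm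
  refine ⟨fun θ => (g θ₀)⁻¹ * k θ, (inAlg_const hA _).mul hA ((hiff _).2 ⟨k, hk, rfl⟩), ?_⟩
  filter_upwards [hχ1] with θ hθ
  have h1 : (1 - u θ) * k θ = 1 := congrArg (fun F : C(AddCircle (2 * Real.pi), ℂ) => F θ) hk1
  rw [congrFun hu' θ, hθ] at h1
  rw [← h1]
  field_simp
  push_cast
  ring

/-- The germ of `f` at `θ₀` is the germ of an element of the algebra. -/
def AlgGerm (A : Set (ℤ → ℂ)) (f : Real.Angle → ℂ) (θ₀ : Real.Angle) : Prop :=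
  ∃ g, InAlg A g ∧ f =ᶠ[𝓝 θ₀] g

variable {f g : Real.Angle → ℂ} {θ₀ : Real.Angle}

theorem InAlg.algGerm (hf : InAlg A f) : AlgGerm A f θ₀ := ⟨f, hf, .rfl⟩

theorem AlgGerm.continuousAt (hf : AlgGerm A f θ₀) : ContinuousAt f θ₀ := by
  obtain ⟨g, hg, h⟩ := hf
  exact hg.1.continuousAt.congr h.symm

theorem AlgGerm.add (hA : IsSeqAlgebra A) (hf : AlgGerm A f θ₀) (hg : AlgGerm A g θ₀) :
    AlgGerm A (fun θ => f θ + g θ) θ₀ := by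
  obtain ⟨F, hF, h1⟩ := hf
  obtain ⟨G, hG, h2⟩ := hg
  exact ⟨_, hF.add hA hG, h1.add h2⟩

theorem AlgGerm.mul (hA : IsSeqAlgebra A) (hf : AlgGerm A f θ₀) (hg : AlgGerm A g θ₀) :
    AlgGerm A (fun θ => f θ * g θ) θ₀ := by
  obtain ⟨F, hF, h1⟩ := hf
  obtain ⟨G, hG, h2⟩ := hg
  exact ⟨_, hF.mul hA hG, h1.mul h2⟩

theorem AlgGerm.inv (hA : IsSeqAlgebra A) (hf : AlgGerm A f θ₀) (h0 : f θ₀ ≠ 0) :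
    AlgGerm A (fun θ => (f θ)⁻¹) θ₀ := by
  obtain ⟨F, hF, h1⟩ := hf
  rw [h1.eq_of_nhds] at h0
  obtain ⟨G, hG, h2⟩ := hF.exists_local_inverse hA h0
  refine ⟨G, hG, ?_⟩
  filter_upwards [h1, h2] with θ h3 h4
  rw [h3, inv_eq_of_mul_eq_one_right h4]

theorem algGerm_const (hA : IsSeqAlgebra A) (c : ℂ) : AlgGerm A (fun _ => c) θ₀ :=
  (inAlg_const hA c).algGerm

theorem algGerm_cos (hA : IsSeqAlgebra A) : AlgGerm A (fun θ => (θ.cos : ℂ)) θ₀ :=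
  (inAlg_of_contDiff hA (Complex.ofRealCLM.contDiff.comp Real.contDiff_cos)).algGerm

theorem algGerm_sin (hA : IsSeqAlgebra A) : AlgGerm A (fun θ => (θ.sin : ℂ)) θ₀ :=
  (inAlg_of_contDiff hA (Complex.ofRealCLM.contDiff.comp Real.contDiff_sin)).algGerm

/-- For the converse, a cutoff supported where `f` agrees with `g` turns `χ f` into `χ g`, a product
in the algebra. -/
theorem inAlgLocAt_iff (hA : IsSeqAlgebra A) : InAlgLocAt A f θ₀ ↔ AlgGerm A f θ₀ := by
  constructor
  · rintro ⟨χ, -, h1, h2⟩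
    refine ⟨_, h2, ?_⟩
    filter_upwards [h1] with θ h
    simp [h]
  · rintro ⟨g, hg, h⟩
    obtain ⟨χ, hχ, hχ1, hχU⟩ := exists_isSmoothBump θ₀ h
    refine ⟨χ, hχ, hχ1, ?_⟩
    convert (hχ.inAlg hA).mul hA hg using 2 with θ
    by_cases hθ : χ θ = 0
    · simp [hθ]
    · rw [show f θ = g θ from hχU (subset_tsupport _ hθ)]

theorem isOpen_openArc (α β : ℝ) : IsOpen (openArc α β) :=
  QuotientAddGroup.isOpenMap_coe _ isOpen_Ioo

theorem exists_openArc_subset {U : Set Real.Angle} (hU : U ∈ 𝓝 θ₀) :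
    ∃ α β : ℝ, θ₀ ∈ openArc α β ∧ openArc α β ⊆ U := by
  induction θ₀ using Real.Angle.induction_on with
  | _ x =>
    have h := Real.Angle.continuous_coe.continuousAt.preimage_mem_nhds hU
    obtain ⟨α, β, hx, hsub⟩ := mem_nhds_iff_exists_Ioo_subset.1 h
    exact ⟨α, β, ⟨x, hx, rfl⟩, by rintro _ ⟨y, hy, rfl⟩; exact hsub hy⟩

/-! ### Stability of the boundary class under inversion and affine maps. -/

/-- The endpoint condition in terms of germs. -/
def EndpointGerm (A : Set (ℤ → ℂ)) (f : Real.Angle → ℂ) (θ₀ : Real.Angle) : Prop :=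
  ∃ G, AlgGerm A G θ₀ ∧ (G θ₀).im ≠ 0 ∧
    ((∀ᶠ θ in 𝓝 θ₀, θ.sin ≠ 0 → f θ = G θ / (θ.sin : ℂ)) ∨
      ∃ c : ℝ, ∀ᶠ θ in 𝓝 θ₀, θ.sin ≠ 0 → f θ = (c : ℂ) + (θ.sin : ℂ) * G θ)

theorem endpointCondition_iff : EndpointCondition A f θ₀ ↔ EndpointGerm A f θ₀ := by
  constructor
  · rintro ⟨α, β, hθ₀, χ, -, -, h1, G, hG, him, h⟩
    refine ⟨G, hG.algGerm, him θ₀ hθ₀, ?_⟩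
    rcases h with h | ⟨c, h⟩
    · left
      filter_upwards [h1] with θ h2 hθ
      simpa [h2] using h θ hθ
    · refine Or.inr ⟨c, ?_⟩
      filter_upwards [h1] with θ h2 hθ
      simpa [h2] using h θ hθ
  · rintro ⟨G', ⟨G, hG, hGG'⟩, him, h⟩
    have him' : ∀ᶠ θ in 𝓝 θ₀, (G θ).im ≠ 0 := by
      rw [hGG'.eq_of_nhds] at him
      exact (Complex.continuous_im.comp hG.1).continuousAt.eventually_ne him
    -- `P` stands for either normal form, so that the localisation by a cutoff is done once.
    obtain ⟨P, hP, hPdef⟩ : ∃ P : Real.Angle → ℂ, (∀ᶠ θ in 𝓝 θ₀, θ.sin ≠ 0 → f θ = P θ) ∧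
        ((∀ θ, P θ = G θ / (θ.sin : ℂ)) ∨ ∃ c : ℝ, ∀ θ, P θ = (c : ℂ) + (θ.sin : ℂ) * G θ) := by
      rcases h with h | ⟨c, h⟩
      · refine ⟨_, ?_, Or.inl fun θ => rfl⟩
        filter_upwards [h, hGG'] with θ h1 h2
        rwa [h2] at h1
      · refine ⟨_, ?_, Or.inr ⟨c, fun θ => rfl⟩⟩
        filter_upwards [h, hGG'] with θ h1 h2
        rwa [h2] at h1
    obtain ⟨α, β, hθ₀, hsub⟩ := exists_openArc_subset (him'.and hP)
    obtain ⟨χ, hχ, hχ1, hχU⟩ := exists_isSmoothBump θ₀ ((isOpen_openArc α β).mem_nhds hθ₀)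
    refine ⟨α, β, hθ₀, χ, hχ, hχU, hχ1, G, hG, fun θ hθ => (hsub hθ).1, ?_⟩
    have key : ∀ θ : Real.Angle, θ.sin ≠ 0 → (χ θ : ℂ) * f θ = (χ θ : ℂ) * P θ := by
      intro θ hθ
      by_cases h0 : χ θ = 0
      · simp [h0]
      · rw [(hsub (hχU (subset_tsupport _ h0))).2 hθ]
    rcases hPdef with hPd | ⟨c, hPd⟩
    · exact Or.inl fun θ hθ => by rw [key θ hθ, hPd]
    · exact Or.inr ⟨c, fun θ hθ => by rw [key θ hθ, hPd]⟩

theorem Complex.inv_im_ne_zero {z : ℂ} (hz : z.im ≠ 0) : (z⁻¹).im ≠ 0 := by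
  have : z ≠ 0 := by rintro rfl; simp at hz
  rw [Complex.inv_im]
  exact div_ne_zero (neg_ne_zero.2 hz) (Complex.normSq_pos.2 this).ne'

/-- `G / sin` and `sin · G` are exchanged. For `c ≠ 0`, `1 / (c + sin · G) = 1 / c - sin · G / (c (c
+ sin · G))`; the new factor equals `-G / c²` at `θ₀`, so its imaginary part is nonzero there. -/
theorem EndpointGerm.inv (hA : IsSeqAlgebra A) (h0 : θ₀.sin = 0) (hf : EndpointGerm A f θ₀) :
    EndpointGerm A (fun θ => (f θ)⁻¹) θ₀ := by
  obtain ⟨G, hG, him, h⟩ := hf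
  have hG0 : G θ₀ ≠ 0 := by intro h; simp [h] at him
  rcases h with h | ⟨c, h⟩
  · refine ⟨_, hG.inv hA hG0, Complex.inv_im_ne_zero him, Or.inr ⟨0, ?_⟩⟩
    filter_upwards [h] with θ h1 hθ
    rw [h1 hθ, inv_div, Complex.ofReal_zero, zero_add, div_eq_mul_inv]
  · rcases eq_or_ne c 0 with rfl | hc
    · refine ⟨_, hG.inv hA hG0, Complex.inv_im_ne_zero him, Or.inl ?_⟩
      filter_upwards [h] with θ h1 hθ
      rw [h1 hθ, Complex.ofReal_zero, zero_add, mul_inv, mul_comm, div_eq_mul_inv]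
    · have hc' : (c : ℂ) ≠ 0 := by exact_mod_cast hc
      have hd : AlgGerm A (fun θ => (c : ℂ) + (θ.sin : ℂ) * G θ) θ₀ :=
        (algGerm_const hA _).add hA ((algGerm_sin hA).mul hA hG)
      have hd0 : (c : ℂ) + (θ₀.sin : ℂ) * G θ₀ ≠ 0 := by simpa [h0] using hc
      refine ⟨fun θ => ((-(c : ℂ)⁻¹) * G θ) * ((c : ℂ) + (θ.sin : ℂ) * G θ)⁻¹,
        ((algGerm_const hA _).mul hA hG).mul hA (hd.inv hA hd0), ?_, Or.inr ⟨c⁻¹, ?_⟩⟩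
      · have e : -(c : ℂ)⁻¹ * G θ₀ * ((c : ℂ) + (θ₀.sin : ℂ) * G θ₀)⁻¹
            = ((-(c⁻¹ * c⁻¹) : ℝ) : ℂ) * G θ₀ := by
          rw [h0]
          push_cast
          rw [zero_mul, add_zero]
          ring
        beta_reduce
        rw [e, Complex.im_ofReal_mul]
        exact mul_ne_zero (neg_ne_zero.2 (by positivity)) him
      · filter_upwards [h, hd.continuousAt.eventually_ne hd0] with θ h1 h2 hθ
        rw [h1 hθ]
        push_cast
        field_simp
        ring

/-- In the form `G / sin`, the added terms enter multiplied by `sin` and vanish at `θ₀`. In the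
other form, with `e = cos θ₀ = ±1`, the identity `cos θ = e - sin² θ / (cos θ + e)` sends `y e` into
the real constant and the rest into `sin · G`. -/
theorem EndpointGerm.affine (hA : IsSeqAlgebra A) (h0 : θ₀.sin = 0) (hf : EndpointGerm A f θ₀)
    {x : ℝ} (hx : x ≠ 0) (y b : ℝ) :
    EndpointGerm A (fun θ => (x : ℂ) * f θ + ((y : ℂ) * (θ.cos : ℂ) + (b : ℂ))) θ₀ := by
  obtain ⟨G, hG, him, h⟩ := hf
  rcases h with h | ⟨c, h⟩
  · refine ⟨fun θ => (x : ℂ) * G θ + (θ.sin : ℂ) * ((y : ℂ) * (θ.cos : ℂ) + (b : ℂ)),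
      ((algGerm_const hA _).mul hA hG).add hA ((algGerm_sin hA).mul hA
        (((algGerm_const hA _).mul hA (algGerm_cos hA)).add hA (algGerm_const hA _))), ?_,
      Or.inl ?_⟩
    · beta_reduce
      rw [h0, Complex.ofReal_zero, zero_mul, add_zero, Complex.im_ofReal_mul]
      exact mul_ne_zero hx him
    · filter_upwards [h] with θ h1 hθ
      have hθ' : (θ.sin : ℂ) ≠ 0 := by exact_mod_cast hθ
      rw [h1 hθ]
      field_simp
  · set e := θ₀.cos with he
    have he2 : e ^ 2 = 1 := by
      have := Real.Angle.cos_sq_add_sin_sq θ₀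
      rw [h0] at this
      linarith
    have he0 : e ≠ 0 := by rintro h; rw [h] at he2; norm_num at he2
    have hd : AlgGerm A (fun θ => (θ.cos : ℂ) + (e : ℂ)) θ₀ :=
      (algGerm_cos hA).add hA (algGerm_const hA _)
    have hd0 : (θ₀.cos : ℂ) + (e : ℂ) ≠ 0 := by
      rw [← he]
      norm_cast
      contrapose! he0
      linarith
    refine ⟨fun θ => (x : ℂ) * G θ + (θ.sin : ℂ) * ((-(y : ℂ)) * ((θ.cos : ℂ) + (e : ℂ))⁻¹),
      ((algGerm_const hA _).mul hA hG).add hA ((algGerm_sin hA).mul hA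
        ((algGerm_const hA _).mul hA (hd.inv hA hd0))), ?_, Or.inr ⟨x * c + y * e + b, ?_⟩⟩
    · beta_reduce
      rw [h0, Complex.ofReal_zero, zero_mul, add_zero, Complex.im_ofReal_mul]
      exact mul_ne_zero hx him
    · filter_upwards [h, hd.continuousAt.eventually_ne hd0] with θ h1 h2 hθ
      have h3 : (θ.cos : ℂ) ^ 2 + (θ.sin : ℂ) ^ 2 = 1 := by
        exact_mod_cast Real.Angle.cos_sq_add_sin_sq θ
      have h4 : (e : ℂ) ^ 2 = 1 := by exact_mod_cast he2
      rw [h1 hθ]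
      push_cast
      field_simp
      linear_combination (y : ℂ) * h3 - (y : ℂ) * h4

theorem EndpointGerm.congr (hf : EndpointGerm A f θ₀)
    (h : ∀ θ : Real.Angle, θ.sin ≠ 0 → g θ = f θ) : EndpointGerm A g θ₀ := by
  obtain ⟨G, hG, him, h1⟩ := hf
  refine ⟨G, hG, him, h1.imp (fun h2 => ?_) fun ⟨c, h2⟩ => ⟨c, ?_⟩⟩
  all_goals
    filter_upwards [h2] with θ h3 hθ
    rw [h θ hθ, h3 hθ]

/-- The conditions on the boundary function in the definition of `InClassM`, in terms of germs. -/
def BoundaryClass (A : Set (ℤ → ℂ)) (f : Real.Angle → ℂ) : Prop :=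
  (∀ θ : Real.Angle, θ.sin ≠ 0 → AlgGerm A f θ ∧ (f θ).im ≠ 0) ∧
    ∀ θ : Real.Angle, θ.sin = 0 → EndpointGerm A f θ

theorem inClassM_iff (hA : IsSeqAlgebra A) {M : ℂ → ℂ} :
    InClassM A M ↔ ∃ f, IsBoundaryFunction M f ∧ BoundaryClass A f := by
  unfold InClassM
  refine exists_congr fun f => and_congr_right fun _ => ?_
  rw [endpointCondition_iff, endpointCondition_iff]
  refine and_congr ⟨fun h θ hθ => ?_, fun h α β hαβ => ⟨fun θ hθ => ?_, fun θ hθ => ?_⟩⟩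
    ⟨fun h θ hθ => ?_, fun h => ⟨h 0 (by simp), h _ (by simp)⟩⟩
  · obtain ⟨α, β, h1, h2⟩ := exists_openArc_subset (U := {θ : Real.Angle | θ.sin ≠ 0})
      (Real.Angle.continuous_sin.continuousAt.eventually_ne hθ)
    obtain ⟨h3, h4⟩ := h α β h2
    exact ⟨(inAlgLocAt_iff hA).1 (h3 θ h1), h4 θ h1⟩
  · exact (inAlgLocAt_iff hA).2 (h θ (hαβ θ hθ)).1
  · exact (h θ (hαβ θ hθ)).2
  · rcases Real.Angle.sin_eq_zero_iff.1 hθ with rfl | rfl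
    exacts [h.1, h.2]

theorem BoundaryClass.inv (hA : IsSeqAlgebra A) (hf : BoundaryClass A f) :
    BoundaryClass A (fun θ => (f θ)⁻¹) := by
  refine ⟨fun θ hθ => ?_, fun θ hθ => (hf.2 θ hθ).inv hA hθ⟩
  obtain ⟨h1, h2⟩ := hf.1 θ hθ
  exact ⟨h1.inv hA fun h => by simp [h] at h2, Complex.inv_im_ne_zero h2⟩

theorem BoundaryClass.affine (hA : IsSeqAlgebra A) (hf : BoundaryClass A f)
    {x : ℝ} (hx : x ≠ 0) (y b : ℝ) :
    BoundaryClass A (fun θ => (x : ℂ) * f θ + ((y : ℂ) * (θ.cos : ℂ) + (b : ℂ))) := by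
  refine ⟨fun θ hθ => ?_, fun θ hθ => (hf.2 θ hθ).affine hA hθ hx y b⟩
  obtain ⟨h1, h2⟩ := hf.1 θ hθ
  refine ⟨((algGerm_const hA _).mul hA h1).add hA
    (((algGerm_const hA _).mul hA (algGerm_cos hA)).add hA (algGerm_const hA _)), ?_⟩
  simpa using ⟨hx, h2⟩

end InAlg

/-! ### Radial limits and conclusion. -/

theorem Real.Angle.ofReal_mul_toCircle_inv (r : ℝ) (θ : Real.Angle) :
    ((r : ℂ) * (θ.toCircle : ℂ))⁻¹ = (r : ℂ)⁻¹ * ((θ.cos : ℂ) - θ.sin * Complex.I) := by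
  rw [mul_inv, ← Circle.coe_inv, Circle.coe_inv_eq_conj, Real.Angle.coe_toCircle]
  simp [sub_eq_add_neg]

/-- The imaginary part is `(r - r⁻¹) sin θ`, so the stripping relation is available along the whole
radius. -/
theorem im_joukowski_ne_zero {θ : Real.Angle} (hθ : θ.sin ≠ 0) {r : ℝ} (h0 : 0 < r) (h1 : r < 1) :
    ((r : ℂ) * (θ.toCircle : ℂ) + ((r : ℂ) * (θ.toCircle : ℂ))⁻¹).im ≠ 0 := by
  rw [Real.Angle.ofReal_mul_toCircle_inv, Real.Angle.coe_toCircle, ← Complex.ofReal_inv]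
  have e : ((r : ℂ) * ((θ.cos : ℂ) + θ.sin * Complex.I) +
      (r⁻¹ : ℝ) * ((θ.cos : ℂ) - θ.sin * Complex.I)).im = (r - r⁻¹) * θ.sin := by
    simp
    ring
  rw [e]
  have : 1 < r⁻¹ := (one_lt_inv₀ h0).2 h1
  exact mul_ne_zero (by linarith) hθ

theorem tendsto_joukowski (θ : Real.Angle) :
    Tendsto (fun r : ℝ => (r : ℂ) * (θ.toCircle : ℂ) + ((r : ℂ) * (θ.toCircle : ℂ))⁻¹) (𝓝[<] 1)
      (𝓝 (2 * (θ.cos : ℂ))) := by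
  have hr : Tendsto (fun r : ℝ => (r : ℂ)) (𝓝[<] 1) (𝓝 1) :=
    (Complex.continuous_ofReal.tendsto' 1 1 Complex.ofReal_one).mono_left nhdsWithin_le_nhds
  simp_rw [Real.Angle.ofReal_mul_toCircle_inv, Real.Angle.coe_toCircle]
  have h := (hr.mul_const ((θ.cos : ℂ) + θ.sin * Complex.I)).add
    ((hr.inv₀ one_ne_zero).mul_const ((θ.cos : ℂ) - θ.sin * Complex.I))
  convert h using 2
  rw [inv_one]
  ring

theorem JacobiMatrix.inClassM_iff_removeFirst {A : Set (ℤ → ℂ)} (hA : IsSeqAlgebra A)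
    (J : JacobiMatrix) : InClassM A J.MFun ↔ InClassM A J.removeFirst.MFun := by
  rw [inClassM_iff hA, inClassM_iff hA]
  have ha : J.a 0 ≠ 0 := (J.a_pos 0).ne'
  have ha' : (J.a 0 : ℂ) ≠ 0 := by exact_mod_cast ha
  have hr : ∀ᶠ r : ℝ in 𝓝[<] 1, 0 < r ∧ r < 1 :=
    Filter.Eventually.and (nhdsWithin_le_nhds (lt_mem_nhds one_pos)) self_mem_nhdsWithin
  constructor
  · rintro ⟨f, hM, hf⟩
    -- The coefficients come from solving the relation: `M⁽¹⁾ = (2 cos θ - b₁ - 1 / M) / a₁²`.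
    refine ⟨_, fun θ hθ => ?_, (hf.inv hA).affine hA (x := -(J.a 0 ^ 2)⁻¹)
      (neg_ne_zero.2 (by positivity)) (2 * (J.a 0 ^ 2)⁻¹) (-J.b 0 * (J.a 0 ^ 2)⁻¹)⟩
    have h0 : f θ ≠ 0 := fun h => (hf.1 θ hθ).2 (by simp [h])
    have h := (((tendsto_joukowski θ).sub_const (J.b 0 : ℂ)).sub ((hM θ hθ).inv₀ h0)).mul_const
      ((J.a 0 : ℂ) ^ 2)⁻¹
    refine (h.congr' ?_).trans_eq ?_
    · filter_upwards [hr] with r hr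
      have hrel := J.MFun_mul_removeFirst (im_joukowski_ne_zero hθ hr.1 hr.2)
      rw [inv_eq_of_mul_eq_one_right hrel]
      field_simp
      ring
    · congr 1
      push_cast
      ring
  · rintro ⟨f, hM, hf⟩
    have hcl := hf.affine hA (x := -(J.a 0 ^ 2)) (neg_ne_zero.2 (by positivity)) 2 (-J.b 0)
    refine ⟨_, fun θ hθ => ?_, hcl.inv hA⟩
    -- The denominator `2 cos θ - b₁ - a₁² M⁽¹⁾` has nonzero imaginary part, so the radial limit may
    -- be inverted.
    have h0 := (hcl.1 θ hθ).2
    beta_reduce at h0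
    have h := ((tendsto_joukowski θ).sub_const (J.b 0 : ℂ)).sub
      ((hM θ hθ).const_mul ((J.a 0 : ℂ) ^ 2))
    have e : 2 * (θ.cos : ℂ) - J.b 0 - (J.a 0 : ℂ) ^ 2 * f θ =
        ((-(J.a 0 ^ 2) : ℝ) : ℂ) * f θ + (((2 : ℝ) : ℂ) * (θ.cos : ℂ) + ((-J.b 0 : ℝ) : ℂ)) := by
      push_cast
      ring
    rw [e] at h
    refine (h.inv₀ fun h1 => h0 (by rw [h1]; rfl)).congr' ?_
    filter_upwards [hr] with r hr
    exact inv_eq_of_mul_eq_one_left (J.MFun_mul_removeFirst (im_joukowski_ne_zero hθ hr.1 hr.2))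

theorem mainTheorem3 (A : Set (ℤ → ℂ)) (hA : IsSeqAlgebra A) :
    (∀ J : JacobiMatrix, InClassM A J.MFun ↔ InClassM A J.removeFirst.MFun) ∧
      (∀ J J' : JacobiMatrix, J.removeFirst = J'.removeFirst →
        (InClassM A J.MFun ↔ InClassM A J'.MFun)) := by
  refine ⟨JacobiMatrix.inClassM_iff_removeFirst hA, fun J J' h => ?_⟩
  rw [J.inClassM_iff_removeFirst hA, h, ← J'.inClassM_iff_removeFirst hA]
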